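/- A hyperplane process in $\mathbb R^n$ ($n\ge 1$) is a random locally finite counting measure on the space of hyperplanes $H(u,\tau)=\{x:\langle x,u\rangle=\tau\}$, $|u|=1$, $\tau\in\mathbb R$. It is stationary (isotropic) if its distribution is invariant under translations (rotations about the origin). It has intensity $\gamma\in(0,\infty)$ if its intensity measure is $\Theta(A)=2\gamma\int_{S^{n-1}}\int_0^\infty \mathbf 1\{H(u,\tau)\in A\}\,d\tau\,\phi(du)$ for a probability measure $\phi$ on $S^{n-1}$. It is Poisson if the numbers of hyperplanes in disjoint Borel sets of finite $\Theta$-measure are independent Poisson variables whose means are given by $\Theta$. Its zero cell is the cell of the induced tessellation (the closure of a connected component of the complement of the union of the hyperplanes) that contains the origin. For $C\subset\mathbb R^n$ let $R_M(C)=\inf\{r>0: C\subset B(r)\}$, where $B(r)$ is the ball of radius $r$ centred at the origin. **Theorem.** Let $R>0$. There is $\rho_u>\frac{\sqrt\pi}{R\sqrt2}$, depending only on $R$, such that the following holds for all $\rho>\rho_u$ and all $\alpha\in\mathbb R$: if for each $n\ge1$, $Z_{0,n}$ is the zero cell of a stationary and isotropic Poisson hyperplane process in $\mathbb R^n$ with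 intensity $\gamma_n$, and $\gamma_n\sim\rho n^\alpha$ as $n\to\infty$, then $$\lim_{n\to\infty}\mathbb P\left(R_M(Z_{0,n})\ge n^{3/2-\alpha}R\right)=0.$$ Also, there is $\rho_\ell$ with $0<\rho_\ell<\frac{\sqrt\pi}{R\sqrt2}$, depending only on $R$, such that for all $0<\rho<\rho_\ell$ and all $\alpha\in\mathbb R$, under the same assumptions on $Z_{0,n}$ and $\gamma_n$, $$\lim_{n\to\infty}\mathbb P\left(R_M(Z_{0,n})\le n^{3/2-\alpha}R\right)=0.$$ -/

import Mathlib

open MeasureTheory Set Filter Topology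
open scoped ENNReal RealInnerProductSpace

/-- Euclidean space of dimension `n`. -/
abbrev Euc (n : ℕ) : Type := EuclideanSpace ℝ (Fin n)

/-- The set `H(u, τ) = {x : ⟨x, u⟩ = τ}`. -/
def hyperplaneSet {n : ℕ} (u : Euc n) (τ : ℝ) : Set (Euc n) := {x | ⟪x, u⟫ = τ}

/-- The space of hyperplanes of `ℝⁿ`. -/
def Hyperplane (n : ℕ) : Type :=
  {H : Set (Euc n) // ∃ u : Euc n, ‖u‖ = 1 ∧ ∃ τ : ℝ, H = hyperplaneSet u τ}

namespace Hyperplane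

variable {n : ℕ}

/-- The points of a hyperplane. -/
def carrier (H : Hyperplane n) : Set (Euc n) := H.1

/-- `H(u, τ)` as an element of the space of hyperplanes, for a unit vector `u`. -/
def of (u : Metric.sphere (0 : Euc n) 1) (τ : ℝ) : Hyperplane n :=
  ⟨hyperplaneSet (u : Euc n) τ, u, by simp, τ, rfl⟩

/-- The hyperplanes that meet `C`. -/
def hitting (C : Set (Euc n)) : Set (Hyperplane n) := {H | (H.carrier ∩ C).Nonempty}

/-- The Borel `σ`-algebra on the space of hyperplanes: the trace of the Borel `σ`-algebra on
closed sets, which is generated by the families of sets that meet a given compact set. -/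
instance : MeasurableSpace (Hyperplane n) :=
  MeasurableSpace.generateFrom {𝒜 | ∃ C : Set (Euc n), IsCompact C ∧ 𝒜 = hitting C}

/-- The translate `H + t`. -/
def translate (t : Euc n) (H : Hyperplane n) : Hyperplane n :=
  ⟨(fun x => x + t) '' H.carrier, by
    obtain ⟨u, hu, τ, h⟩ := H.2
    refine ⟨u, hu, τ + ⟪t, u⟫, ?_⟩
    ext y
    simp only [carrier, h, hyperplaneSet, mem_image, mem_ofPred_eq]
    constructor
    · rintro ⟨x, hx, rfl⟩
      rw [inner_add_left, hx]
    · intro hy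
      exact ⟨y - t, by rw [inner_sub_left, hy]; ring, by simp⟩⟩

/-- The image of a hyperplane under a linear isometry. -/
def rotate (ϑ : Euc n ≃ₗᵢ[ℝ] Euc n) (H : Hyperplane n) : Hyperplane n :=
  ⟨ϑ '' H.carrier, by
    obtain ⟨u, hu, τ, h⟩ := H.2
    refine ⟨ϑ u, by simpa using hu, τ, ?_⟩
    ext y
    simp only [carrier, h, hyperplaneSet, mem_image, mem_ofPred_eq]
    constructor
    · rintro ⟨x, hx, rfl⟩
      rw [ϑ.inner_map_map, hx]
    · intro hy
      refine ⟨ϑ.symm y, ?_, by simp⟩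
      rw [← ϑ.inner_map_map, ϑ.apply_symm_apply, hy]⟩

theorem measurableSet_hitting {C : Set (Euc n)} (hC : IsCompact C) :
    MeasurableSet (hitting C) :=
  MeasurableSpace.measurableSet_generateFrom ⟨C, hC, rfl⟩

theorem measurable_translate (t : Euc n) : Measurable (translate t) := by
  refine measurable_generateFrom ?_
  rintro _ ⟨C, hC, rfl⟩
  have : translate t ⁻¹' hitting C = hitting ((fun x => x - t) '' C) := by
    ext H
    constructor
    · rintro ⟨_, ⟨x, hx, rfl⟩, hy⟩
      exact ⟨x, hx, _, hy, by simp⟩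
    · rintro ⟨_, hx, ⟨y, hy, rfl⟩⟩
      exact ⟨y, ⟨_, hx, by simp⟩, hy⟩
  rw [this]
  exact measurableSet_hitting (hC.image (by fun_prop))

theorem measurable_rotate (ϑ : Euc n ≃ₗᵢ[ℝ] Euc n) : Measurable (rotate ϑ) := by
  refine measurable_generateFrom ?_
  rintro _ ⟨C, hC, rfl⟩
  have : rotate ϑ ⁻¹' hitting C = hitting (ϑ.symm '' C) := by
    ext H
    constructor
    · rintro ⟨_, ⟨x, hx, rfl⟩, hy⟩
      exact ⟨x, hx, _, hy, by simp⟩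
    · rintro ⟨_, hx, ⟨y, hy, rfl⟩⟩
      exact ⟨y, ⟨_, hx, by simp⟩, hy⟩
  rw [this]
  exact measurableSet_hitting (hC.image ϑ.symm.continuous)

/-- The parametrization `(u, τ) ↦ H(u, τ)` is measurable. -/
theorem measurable_of :
    Measurable (fun p : Metric.sphere (0 : Euc n) 1 × ℝ => of p.1 p.2) := by
  refine measurable_generateFrom ?_
  rintro _ ⟨C, hC, rfl⟩
  have : (fun p : Metric.sphere (0 : Euc n) 1 × ℝ => of p.1 p.2) ⁻¹' hitting C =
      (Prod.fst '' {q : (Metric.sphere (0 : Euc n) 1 × ℝ) × C |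
        ⟪(q.2 : Euc n), (q.1.1 : Euc n)⟫ = q.1.2}) := by
    ext p
    constructor
    · rintro ⟨x, hx, hxC⟩
      exact ⟨(p, ⟨x, hxC⟩), hx, rfl⟩
    · rintro ⟨⟨p, x⟩, hx, rfl⟩
      exact ⟨x, hx, x.2⟩
  rw [this]
  have : CompactSpace C := isCompact_iff_compactSpace.1 hC
  refine IsClosed.measurableSet (isClosedMap_fst_of_compactSpace _ ?_)
  exact isClosed_eq (by fun_prop) (by fun_prop)

end Hyperplane

/-- `μ` is a locally finite counting measure on the space of hyperplanes: a countable (possibly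
finite or empty) sum of unit point masses which charges the hyperplanes meeting any given compact
set only finitely often. -/
def IsLocallyFiniteCounting {n : ℕ} (μ : Measure (Hyperplane n)) : Prop :=
  (∃ (I : Set ℕ) (h : I → Hyperplane n), μ = Measure.sum fun i => Measure.dirac (h i)) ∧
    ∀ C : Set (Euc n), IsCompact C → μ (Hyperplane.hitting C) < ∞

section RandomHyperplanes

variable {Ω : Type*} [MeasurableSpace Ω] {n : ℕ}

/-- A hyperplane process: a random (locally finite) counting measure on the space of
hyperplanes. -/
structure IsHyperplaneProcess (X : Ω → Measure (Hyperplane n)) : Prop where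
  measurable : Measurable X
  counting : ∀ ω, IsLocallyFiniteCounting (X ω)

/-- Stationarity: the distribution of `X` is invariant under translations. -/
def IsStationaryProcess (P : Measure Ω) (X : Ω → Measure (Hyperplane n)) : Prop :=
  ∀ t : Euc n, P.map (fun ω => (X ω).map (Hyperplane.translate t)) = P.map X

/-- Isotropy: the distribution of `X` is invariant under rotations about the origin. -/
def IsIsotropicProcess (P : Measure Ω) (X : Ω → Measure (Hyperplane n)) : Prop :=
  ∀ ϑ : Euc n ≃ₗᵢ[ℝ] Euc n, LinearMap.det (ϑ.toLinearEquiv : Euc n →ₗ[ℝ] Euc n) = 1 →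
    P.map (fun ω => (X ω).map (Hyperplane.rotate ϑ)) = P.map X

/-- The intensity measure `Θ(A) = 𝔼[X(A)]`. -/
noncomputable def intensityMeasure (P : Measure Ω) (X : Ω → Measure (Hyperplane n)) :
    Measure (Hyperplane n) :=
  P.bind X

/-- The process `X` is Poisson: the numbers of hyperplanes in disjoint Borel sets of finite
intensity measure are independent Poisson variables with means given by the intensity measure. -/
def IsPoissonProcess (P : Measure Ω) (X : Ω → Measure (Hyperplane n)) : Prop :=
  ∀ (k : ℕ) (A : Fin k → Set (Hyperplane n)) (m : Fin k → ℕ),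
    (∀ i, MeasurableSet (A i)) → Pairwise (Function.onFun Disjoint A) →
    (∀ i, intensityMeasure P X (A i) < ∞) →
    P {ω | ∀ i, X ω (A i) = (m i : ℝ≥0∞)} =
      ENNReal.ofReal (∏ i, (intensityMeasure P X (A i)).toReal ^ m i / ((m i).factorial : ℝ) *
        Real.exp (-(intensityMeasure P X (A i)).toReal))

/-- `X` has intensity `γ ∈ (0, ∞)`: for some probability measure `φ` on the unit sphere (the
spherical directional distribution), the intensity measure `Θ` of `X` satisfies
`∫ f dΘ = 2 γ ∫_{S^{n-1}} ∫_0^∞ f(H(u, τ)) dτ φ(du)` for all nonnegative measurable `f`. -/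
def HasIntensity (P : Measure Ω) (X : Ω → Measure (Hyperplane n)) (γ : ℝ) : Prop :=
  0 < γ ∧ ∃ φ : Measure (Metric.sphere (0 : Euc n) 1), IsProbabilityMeasure φ ∧
    ∀ f : Hyperplane n → ℝ≥0∞, Measurable f →
      ∫⁻ H, f H ∂(intensityMeasure P X) =
        ENNReal.ofReal (2 * γ) * ∫⁻ u, (∫⁻ τ in Ioi (0 : ℝ), f (Hyperplane.of u τ)) ∂φ

/-- `X` is a stationary and isotropic Poisson hyperplane process in `ℝⁿ` with intensity `γ`. -/
structure IsStationaryIsotropicPoisson (P : Measure Ω) (X : Ω → Measure (Hyperplane n))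
    (γ : ℝ) : Prop where
  process : IsHyperplaneProcess X
  stationary : IsStationaryProcess P X
  isotropic : IsIsotropicProcess P X
  poisson : IsPoissonProcess P X
  intensity : HasIntensity P X γ

end RandomHyperplanes

section ZeroCell

variable {n : ℕ}

/-- The union of the hyperplanes of the counting measure `μ`. -/
def hyperplaneUnion (μ : Measure (Hyperplane n)) : Set (Euc n) :=
  ⋃ H ∈ {H : Hyperplane n | μ {H} ≠ 0}, H.carrier

/-- The zero cell of the tessellation induced by `μ`. The cells are the closures of the connected
components of the complement of the union of the hyperplanes; the zero cell is the one that
contains the origin in its interior (it is empty if the origin lies on a hyperplane). -/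
def zeroCell (μ : Measure (Hyperplane n)) : Set (Euc n) :=
  closure (connectedComponentIn (hyperplaneUnion μ)ᶜ 0)

/-- `R_M(C) = inf {r > 0 : C ⊆ B(r)}`, which is `∞` if `C` is unbounded. -/
noncomputable def radiusM (C : Set (Euc n)) : ℝ≥0∞ :=
  sInf {s | ∃ r : ℝ, 0 < r ∧ C ⊆ Metric.closedBall 0 r ∧ s = ENNReal.ofReal r}

end ZeroCell

/-!
Both bounds come from counting hyperplanes near the origin. In the scale of `r = n^{3/2-α} R`, of the
order of `ρ R n` hyperplanes have distance at most `r / √n` from the origin, and a fixed unit vector `v` has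
`⟪v, u⟫` of order `1 / √n` for a typical normal `u`. So for large `ρ` there are many more relevant
hyperplanes than dimensions, and for small `ρ` many fewer. Only crude constants are needed, since
`ρ_u` may be large and `ρ_ℓ` small.

The probabilistic input is the exponential Markov inequality for Poisson integrals,
`IsPoissonProcess.measure_lintegral_gt_le`, and the lower tail `IsPoissonProcess.measure_count_le` of
a Poisson count. Isotropy enters only through `IsRotationInvariant`: the law of `⟪w, u⟫` depends on
`‖w‖` alone. Averaging over sign vectors shows that this law is subgaussian
(`IsRotationInvariant.lintegral_exp_le`), averaging over an orthonormal basis gives its variance, and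
the two together show that it is not concentrated near zero (`IsRotationInvariant.measure_half_le`).

*Upper bound.* The zero cell lies in the ball of radius `r` as soon as every point `r v` of the sphere
is cut off by a hyperplane. For a fixed `v` the total excess of `r v` beyond the hyperplanes near the
origin is of the order of its mean up to a probability exponentially small in the number of relevant
hyperplanes. A net with constant mesh has only exponentially many points, and between points of the
net the excess varies by at most the seminorm `w ↦ ∑ |⟪w, u⟫|`, which is controlled on the same net
(`radiusM_zeroCell_le_of_net`).

*Lower bound.* Here a point far from the origin must be found that satisfies `|⟪x, u⟫| < τ` for all
hyperplanes `H(u, τ)`. Round the numbers `⟪ε, u⟫` for a sign vector `ε` to multiples of `τ / (2 s)`.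
The rounded values can be encoded at a cost whose integral over all scales is finite, so that with
high probability the average total cost is a small multiple of `n`. Then exponentially many sign
vectors, more than a Hamming ball of radius `n / 9` contains, share all their rounded values, and the
scaled difference of two distant ones is the required point (`lt_radiusM_zeroCell_of_signCost`). This
is the pigeonhole argument of partial colouring.
-/

/-! ### Exponential moments and tail bounds for Poisson processes -/

/-- The exponential moments of the Poisson distribution. -/
theorem lintegral_exp_poissonMeasure (r : NNReal) (a : ℝ) :
    ∫⁻ m : ℕ, ENNReal.ofReal (Real.exp (a * m)) ∂(ProbabilityTheory.poissonMeasure r) =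
      ENNReal.ofReal (Real.exp (r * (Real.exp a - 1))) := by
  rw [lintegral_countable']
  have h := (ProbabilityTheory.hasSum_one_poissonMeasure
    (r * (Real.exp a).toNNReal)).mul_left (Real.exp (r * (Real.exp a - 1)))
  rw [mul_one] at h
  rw [← h.tsum_eq, ENNReal.ofReal_tsum_of_nonneg (fun m => by positivity) h.summable]
  congr 1
  ext m
  rw [ProbabilityTheory.poissonMeasure_singleton, ← ENNReal.ofReal_mul (by positivity)]
  congr 1
  push_cast
  rw [Real.coe_toNNReal _ (Real.exp_pos a).le, mul_pow, ← Real.exp_nat_mul, mul_comm (m : ℝ) a]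
  have : Real.exp (-(r : ℝ)) = Real.exp (r * (Real.exp a - 1)) * Real.exp (-(r * Real.exp a)) := by
    rw [← Real.exp_add]; ring_nf
  rw [this]
  ring

section Laplace

variable {Ω : Type*} [MeasurableSpace Ω] {n : ℕ} {P : Measure Ω} [IsProbabilityMeasure P]
  {X : Ω → Measure (Hyperplane n)}

/-- The joint law of the numbers of hyperplanes in finitely many disjoint sets is a product of
Poisson distributions. The counts are turned into natural numbers by `ENNReal.toReal` and
`Nat.floor`, which loses nothing on an almost sure event. -/
theorem IsPoissonProcess.map_counts (hX : IsHyperplaneProcess X) (hP : IsPoissonProcess P X)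
    {k : ℕ} {A : Fin k → Set (Hyperplane n)} (hA : ∀ i, MeasurableSet (A i))
    (hd : Pairwise (Function.onFun Disjoint A)) (hf : ∀ i, intensityMeasure P X (A i) < ∞) :
    P.map (fun ω i => ⌊(X ω (A i)).toReal⌋₊) =
        Measure.pi (fun i => ProbabilityTheory.poissonMeasure
          (intensityMeasure P X (A i)).toNNReal) ∧
      ∀ᵐ ω ∂P, ∀ i, X ω (A i) = (⌊(X ω (A i)).toReal⌋₊ : ℝ≥0∞) := by
  set N : Ω → Fin k → ℕ := fun ω i => ⌊(X ω (A i)).toReal⌋₊ with hN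
  set ν := Measure.pi (fun i => ProbabilityTheory.poissonMeasure
          (intensityMeasure P X (A i)).toNNReal) with hν
  have hXA : ∀ i, Measurable fun ω => X ω (A i) := fun i =>
    (Measure.measurable_coe (hA i)).comp hX.measurable
  have hNm : Measurable N := measurable_pi_lambda _ fun i =>
    Nat.measurable_floor.comp (hXA i).ennreal_toReal
  have hE : ∀ m : Fin k → ℕ, MeasurableSet {ω | ∀ i, X ω (A i) = (m i : ℝ≥0∞)} := fun m => by
    simp only [ofPred_forall]
    exact MeasurableSet.iInter fun i => hXA i (measurableSet_singleton _)
  have hval : ∀ m : Fin k → ℕ, P {ω | ∀ i, X ω (A i) = (m i : ℝ≥0∞)} = ν {m} := fun m => by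
    rw [hP k A m hA hd hf, hν, Measure.pi_singleton, ENNReal.ofReal_prod_of_nonneg
      (fun i _ => by positivity)]
    refine Finset.prod_congr rfl fun i _ => ?_
    rw [ProbabilityTheory.poissonMeasure_singleton, ENNReal.coe_toNNReal_eq_toReal]
    congr 1
    ring
  have hsub : ∀ m : Fin k → ℕ, {ω | ∀ i, X ω (A i) = (m i : ℝ≥0∞)} ⊆ N ⁻¹' {m} := by
    intro m ω hω
    ext i
    simp [hN, hω i]
  have : IsProbabilityMeasure (P.map N) := Measure.isProbabilityMeasure_map hNm.aemeasurable
  constructor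
  · symm
    refine Measure.eq_of_le_of_isProbabilityMeasure (Measure.le_iff.2 fun s _ => ?_)
    rw [← Measure.tsum_indicator_apply_singleton ν s (.of_discrete),
      ← Measure.tsum_indicator_apply_singleton (P.map N) s (.of_discrete)]
    refine ENNReal.tsum_le_tsum fun m => indicator_le_indicator ?_
    rw [← hval, Measure.map_apply hNm (.of_discrete)]
    exact measure_mono (hsub m)
  · have h1 : P (⋃ m : Fin k → ℕ, {ω | ∀ i, X ω (A i) = (m i : ℝ≥0∞)}) = 1 := by
      rw [measure_iUnion _ hE]
      · simp_rw [hval]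
        have := Measure.tsum_indicator_apply_singleton ν univ .univ
        simpa using this
      · intro m m' hmm
        refine Disjoint.mono (hsub m) (hsub m') ?_
        exact Disjoint.preimage _ (by simpa using hmm)
    have h2 := (prob_compl_eq_zero_iff (MeasurableSet.iUnion hE)).2 h1
    filter_upwards [compl_mem_ae_iff.2 h2] with ω hω i
    rw [compl_compl, mem_iUnion] at hω
    obtain ⟨m, hm⟩ := hω
    rw [hm i]
    simp

/-- Joint exponential moments of the numbers of hyperplanes in disjoint sets. -/
theorem IsPoissonProcess.lintegral_exp_counts (hX : IsHyperplaneProcess X)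
    (hP : IsPoissonProcess P X) {ι : Type*} [Fintype ι] {A : ι → Set (Hyperplane n)}
    (hA : ∀ i, MeasurableSet (A i)) (hd : Pairwise (Function.onFun Disjoint A))
    (hf : ∀ i, intensityMeasure P X (A i) < ∞) (a : ι → ℝ) :
    ∫⁻ ω, ENNReal.ofReal (Real.exp (∑ i, a i * (X ω (A i)).toReal)) ∂P =
        ENNReal.ofReal (Real.exp (∑ i, (intensityMeasure P X (A i)).toReal *
          (Real.exp (a i) - 1))) ∧ ∀ᵐ ω ∂P, ∀ i, X ω (A i) < ∞ := by
  classical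
  let e := (Fintype.equivFin ι).symm
  obtain ⟨h1, h2⟩ := hP.map_counts (A := fun j => A (e j)) hX (fun j => hA _)
    (fun i j hij => hd (e.injective.ne hij)) (fun j => hf _)
  set N : Ω → Fin (Fintype.card ι) → ℕ := fun ω i => ⌊(X ω (A (e i))).toReal⌋₊ with hN
  have hXA : ∀ i, Measurable fun ω => X ω (A i) := fun i =>
    (Measure.measurable_coe (hA i)).comp hX.measurable
  have hNm : Measurable N := measurable_pi_lambda _ fun i =>
    Nat.measurable_floor.comp (hXA _).ennreal_toReal
  constructor
  · have h3 : ∫⁻ ω, ENNReal.ofReal (Real.exp (∑ i, a i * (X ω (A i)).toReal)) ∂P =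
        ∫⁻ ω, ∏ j, ENNReal.ofReal (Real.exp (a (e j) * (N ω j : ℝ))) ∂P := by
      refine lintegral_congr_ae ?_
      filter_upwards [h2] with ω hω
      rw [← ENNReal.ofReal_prod_of_nonneg (fun i _ => by positivity), ← Real.exp_sum,
        ← e.sum_comp]
      congr 2
      refine Finset.sum_congr rfl fun j _ => ?_
      congr 1
      have := congrArg ENNReal.toReal (hω j)
      simpa using this
    have h4 : ∫⁻ ω, ∏ j, ENNReal.ofReal (Real.exp (a (e j) * (N ω j : ℝ))) ∂P =
        ∫⁻ m, ∏ j, ENNReal.ofReal (Real.exp (a (e j) * (m j : ℝ))) ∂(P.map N) :=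
      (lintegral_map (f := fun m : Fin (Fintype.card ι) → ℕ =>
        ∏ j, ENNReal.ofReal (Real.exp (a (e j) * (m j : ℝ)))) (.of_discrete) hNm).symm
    rw [h3, h4, h1, ProbabilityTheory.lintegral_prod_eq_prod_lintegral_of_indepFun Finset.univ
      (fun j (m : Fin (Fintype.card ι) → ℕ) => ENNReal.ofReal (Real.exp (a (e j) * (m j : ℝ))))
      (ProbabilityTheory.iIndepFun_pi (X := fun j (m : ℕ) =>
        ENNReal.ofReal (Real.exp (a (e j) * (m : ℝ)))) fun j => .of_discrete)
      (fun j => .of_discrete), ← e.sum_comp, Real.exp_sum,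
      ENNReal.ofReal_prod_of_nonneg (fun i _ => by positivity)]
    refine Finset.prod_congr rfl fun j _ => ?_
    rw [← ENNReal.coe_toNNReal_eq_toReal, ← lintegral_exp_poissonMeasure]
    exact (measurePreserving_eval (fun i => ProbabilityTheory.poissonMeasure
          (intensityMeasure P X (A (e i))).toNNReal) j).lintegral_comp
          (f := fun m : ℕ => ENNReal.ofReal (Real.exp (a (e j) * (m : ℝ)))) .of_discrete
  · filter_upwards [h2] with ω hω i
    have := hω (e.symm i)
    simp only [Equiv.apply_symm_apply] at this
    rw [this]
    exact ENNReal.natCast_lt_top _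

/-- Lower tail of the number of hyperplanes in a set. -/
theorem IsPoissonProcess.measure_count_le (hX : IsHyperplaneProcess X)
    (hP : IsPoissonProcess P X) {A : Set (Hyperplane n)} (hA : MeasurableSet A)
    {θ : ℝ} (hf : intensityMeasure P X A < ∞) (hθ : ENNReal.ofReal θ ≤ intensityMeasure P X A)
    {b : ℝ} (hb : 0 ≤ b) :
    P {ω | X ω A ≤ ENNReal.ofReal b} ≤ ENNReal.ofReal (Real.exp (b - θ / 2)) := by
  obtain ⟨h1, -⟩ := hP.lintegral_exp_counts (ι := Unit) hX (A := fun _ => A) (fun _ => hA)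
    (fun i j hij => absurd rfl hij) (fun _ => hf) (fun _ => -1)
  simp only [Finset.univ_unique, Finset.sum_const, Finset.card_singleton, one_smul] at h1
  have hXA : Measurable fun ω => X ω A := (Measure.measurable_coe hA).comp hX.measurable
  have h3 := mul_meas_ge_le_lintegral₀ (μ := P)
    (f := fun ω => ENNReal.ofReal (Real.exp (-1 * (X ω A).toReal)))
    (by have := hXA.ennreal_toReal; fun_prop) (ENNReal.ofReal (Real.exp (-b)))
  rw [h1] at h3
  have h4 : P {ω | X ω A ≤ ENNReal.ofReal b} ≤ P {ω | ENNReal.ofReal (Real.exp (-b)) ≤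
      ENNReal.ofReal (Real.exp (-1 * (X ω A).toReal))} := by
    refine measure_mono fun ω hω => ?_
    have : (X ω A).toReal ≤ b := ENNReal.toReal_le_of_le_ofReal hb hω
    exact ENNReal.ofReal_le_ofReal (Real.exp_le_exp.2 (by linarith))
  have hθ' : θ ≤ (intensityMeasure P X A).toReal :=
    (ENNReal.ofReal_le_iff_le_toReal hf.ne).1 hθ
  have h5 : Real.exp (-1) ≤ 1 / 2 := by
    rw [Real.exp_neg, one_div]
    exact inv_anti₀ (by norm_num) (by linarith [Real.add_one_le_exp (1 : ℝ)])
  have h6 : ENNReal.ofReal (Real.exp b) * ENNReal.ofReal (Real.exp (-b)) = 1 := by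
    rw [← ENNReal.ofReal_mul (Real.exp_pos _).le, ← Real.exp_add]; simp
  calc P {ω | X ω A ≤ ENNReal.ofReal b}
      ≤ ENNReal.ofReal (Real.exp b) * (ENNReal.ofReal (Real.exp (-b)) *
        P {ω | ENNReal.ofReal (Real.exp (-b)) ≤
          ENNReal.ofReal (Real.exp (-1 * (X ω A).toReal))}) := by
        rw [← mul_assoc, h6, one_mul]; exact h4
    _ ≤ ENNReal.ofReal (Real.exp b) * ENNReal.ofReal (Real.exp
        ((intensityMeasure P X A).toReal * (Real.exp (-1) - 1))) := by gcongr
    _ ≤ _ := by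
        rw [← ENNReal.ofReal_mul (Real.exp_pos _).le, ← Real.exp_add]
        refine ENNReal.ofReal_le_ofReal (Real.exp_le_exp.2 ?_)
        have h0 : (0 : ℝ) ≤ (intensityMeasure P X A).toReal := ENNReal.toReal_nonneg
        nlinarith

/-- The exponential Markov inequality for the integral of a simple function. -/
theorem IsPoissonProcess.measure_simpleFunc_lintegral_gt_le (hX : IsHyperplaneProcess X)
    (hP : IsPoissonProcess P X) (s : SimpleFunc (Hyperplane n) ℝ≥0∞) (hs : ∀ H, s H < ∞)
    {C : ℝ} (hC : 0 ≤ C)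
    (h : ∫⁻ H, ENNReal.ofReal (Real.exp (s H).toReal - 1) ∂(intensityMeasure P X) ≤
      ENNReal.ofReal C) (a : ℝ) :
    P {ω | ENNReal.ofReal a < ∫⁻ H, s H ∂(X ω)} ≤ ENNReal.ofReal (Real.exp (C - a)) := by
  classical
  set Θ := intensityMeasure P X
  let R := s.range.filter (· ≠ 0)
  let A : R → Set (Hyperplane n) := fun y => s ⁻¹' {(y : ℝ≥0∞)}
  have hA : ∀ y, MeasurableSet (A y) := fun y => s.measurableSet_fiber _
  have hd : Pairwise (Function.onFun Disjoint A) := fun y z hyz =>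
    Disjoint.preimage _ (disjoint_singleton.2 fun h => hyz (Subtype.ext h))
  have hR : ∀ y : R, (y : ℝ≥0∞) ≠ 0 ∧ (y : ℝ≥0∞) < ∞ := by
    rintro ⟨y, hy⟩
    simp only [R, Finset.mem_filter, SimpleFunc.mem_range] at hy
    obtain ⟨⟨H, rfl⟩, h0⟩ := hy
    exact ⟨h0, hs H⟩
  have hpos : ∀ y : R, 0 < Real.exp (y : ℝ≥0∞).toReal - 1 := fun y => by
    have := Real.add_one_lt_exp (ENNReal.toReal_pos (hR y).1 (hR y).2.ne).ne'
    linarith [ENNReal.toReal_nonneg (a := (y : ℝ≥0∞))]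
  have hsum : ∀ (g : ℝ≥0∞ → ℝ≥0∞) (_ : g 0 = 0) (μ : Measure (Hyperplane n)),
      ∫⁻ H, g (s H) ∂μ = ∑ y : R, g y * μ (A y) := by
    intro g hg μ
    have h1 : ∫⁻ H, g (s H) ∂μ = (s.map g).lintegral μ := by
      rw [← SimpleFunc.lintegral_eq_lintegral]; rfl
    rw [h1, SimpleFunc.map_lintegral,
      Finset.sum_coe_sort R (fun y => g y * μ (s ⁻¹' {y})), Finset.sum_filter_of_ne]
    rintro y - hy rfl
    simp [hg] at hy
  have hint : ∑ y : R, ENNReal.ofReal (Real.exp (y : ℝ≥0∞).toReal - 1) * Θ (A y) ≤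
      ENNReal.ofReal C := by
    rw [← hsum (fun y => ENNReal.ofReal (Real.exp y.toReal - 1)) (by simp)]
    exact h
  have hf : ∀ y, Θ (A y) < ∞ := fun y => by
    by_contra hcon
    have h1 := (Finset.single_le_sum (f := fun y : R =>
      ENNReal.ofReal (Real.exp (y : ℝ≥0∞).toReal - 1) * Θ (A y)) (fun _ _ => zero_le)
      (Finset.mem_univ y)).trans hint
    simp only [not_lt, top_le_iff] at hcon
    rw [hcon, ENNReal.mul_top (by simpa using hpos y)] at h1
    exact ENNReal.ofReal_ne_top (top_le_iff.1 h1)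
  obtain ⟨h1, h2⟩ := hP.lintegral_exp_counts hX hA hd hf (fun y => (y : ℝ≥0∞).toReal)
  have hXA : ∀ y, Measurable fun ω => X ω (A y) := fun y =>
    (Measure.measurable_coe (hA y)).comp hX.measurable
  have h3 := mul_meas_ge_le_lintegral₀ (μ := P)
    (f := fun ω => ENNReal.ofReal (Real.exp (∑ y : R, (y : ℝ≥0∞).toReal * (X ω (A y)).toReal)))
    (by have := fun y => (hXA y).ennreal_toReal; fun_prop) (ENNReal.ofReal (Real.exp a))
  have h4 : P {ω | ENNReal.ofReal a < ∫⁻ H, s H ∂(X ω)} ≤ P {ω | ENNReal.ofReal (Real.exp a) ≤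
      ENNReal.ofReal (Real.exp (∑ y : R, (y : ℝ≥0∞).toReal * (X ω (A y)).toReal))} := by
    refine measure_mono_ae ?_
    filter_upwards [h2] with ω hω hlt
    have h5 : ∫⁻ H, s H ∂(X ω) = ∑ y : R, (y : ℝ≥0∞) * X ω (A y) := hsum (fun y => y) rfl _
    refine ENNReal.ofReal_le_ofReal (Real.exp_le_exp.2 ?_)
    have hlt' : ENNReal.ofReal a < ∑ y : R, (y : ℝ≥0∞) * X ω (A y) := h5 ▸ hlt
    have h6 := (ENNReal.ofReal_le_iff_le_toReal (ENNReal.sum_ne_top.2 fun y _ =>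
      ENNReal.mul_ne_top (hR y).2.ne (hω y).ne)).1 hlt'.le
    rw [ENNReal.toReal_sum (fun y _ => ENNReal.mul_ne_top (hR y).2.ne (hω y).ne)] at h6
    simpa [ENNReal.toReal_mul] using h6
  have h7 : ∑ y : R, (Θ (A y)).toReal * (Real.exp (y : ℝ≥0∞).toReal - 1) ≤ C := by
    have := ENNReal.toReal_le_of_le_ofReal hC hint
    rw [ENNReal.toReal_sum (fun y _ => ENNReal.mul_ne_top ENNReal.ofReal_ne_top (hf y).ne)] at this
    simp only [ENNReal.toReal_mul, ENNReal.toReal_ofReal (hpos _).le] at this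
    simpa only [mul_comm] using this
  have h6 : ENNReal.ofReal (Real.exp (-a)) * ENNReal.ofReal (Real.exp a) = 1 := by
    rw [← ENNReal.ofReal_mul (Real.exp_pos _).le, ← Real.exp_add]; simp
  calc P {ω | ENNReal.ofReal a < ∫⁻ H, s H ∂(X ω)}
      ≤ ENNReal.ofReal (Real.exp (-a)) * (ENNReal.ofReal (Real.exp a) *
        P {ω | ENNReal.ofReal (Real.exp a) ≤ ENNReal.ofReal
          (Real.exp (∑ y : R, (y : ℝ≥0∞).toReal * (X ω (A y)).toReal))}) := by
        rw [← mul_assoc, h6, one_mul]; exact h4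
    _ ≤ ENNReal.ofReal (Real.exp (-a)) * ENNReal.ofReal (Real.exp C) := by
        gcongr
        refine h3.trans ?_
        rw [h1]
        exact ENNReal.ofReal_le_ofReal (Real.exp_le_exp.2 h7)
    _ = _ := by
        rw [← ENNReal.ofReal_mul (Real.exp_pos _).le, ← Real.exp_add]
        ring_nf

/-- The exponential Markov inequality for the integral of a nonnegative function against a Poisson
process: `𝔼 exp (∫ f dX) ≤ exp (∫ (exp f - 1) dΘ)`, in the form of a tail bound. -/
theorem IsPoissonProcess.measure_lintegral_gt_le (hX : IsHyperplaneProcess X)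
    (hP : IsPoissonProcess P X) {f : Hyperplane n → ℝ} (hf : Measurable f) (hf0 : ∀ H, 0 ≤ f H)
    {C : ℝ} (hC : 0 ≤ C)
    (h : ∫⁻ H, ENNReal.ofReal (Real.exp (f H) - 1) ∂(intensityMeasure P X) ≤
      ENNReal.ofReal C) (a : ℝ) :
    P {ω | ENNReal.ofReal a < ∫⁻ H, ENNReal.ofReal (f H) ∂(X ω)} ≤
      ENNReal.ofReal (Real.exp (C - a)) := by
  let s := SimpleFunc.eapprox (fun H => ENNReal.ofReal (f H))
  have hfm : Measurable fun H => ENNReal.ofReal (f H) := hf.ennreal_ofReal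
  have hset : {ω | ENNReal.ofReal a < ∫⁻ H, ENNReal.ofReal (f H) ∂(X ω)} =
      ⋃ k, {ω | ENNReal.ofReal a < ∫⁻ H, s k H ∂(X ω)} := by
    ext ω
    rw [mem_ofPred_eq, lintegral_eq_iSup_eapprox_lintegral hfm, lt_iSup_iff, mem_iUnion]
    simp only [mem_ofPred_eq, SimpleFunc.lintegral_eq_lintegral, s]
  have hmono : Monotone fun k => {ω | ENNReal.ofReal a < ∫⁻ H, s k H ∂(X ω)} :=
    fun k l hkl ω hω => lt_of_lt_of_le hω
      (lintegral_mono fun H => SimpleFunc.monotone_eapprox _ hkl H)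
  rw [hset, hmono.measure_iUnion]
  refine iSup_le fun k => hP.measure_simpleFunc_lintegral_gt_le hX (s k)
    (fun H => SimpleFunc.eapprox_lt_top _ _ _) hC (le_trans (lintegral_mono fun H => ?_) h) a
  refine ENNReal.ofReal_le_ofReal (sub_le_sub_right (Real.exp_le_exp.2 ?_) 1)
  refine ENNReal.toReal_le_of_le_ofReal (hf0 H) ?_
  rw [← SimpleFunc.iSup_eapprox_apply hfm H]
  exact le_iSup (fun k => s k H) k

end Laplace

/-! ### Coordinates on the space of hyperplanes and isotropy -/

namespace Hyperplane

variable {n : ℕ}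

theorem infDist_hyperplaneSet {u : Euc n} (hu : ‖u‖ = 1) (τ : ℝ) (x : Euc n) :
    Metric.infDist x (hyperplaneSet u τ) = |⟪x, u⟫ - τ| := by
  have hmem : x - (⟪x, u⟫ - τ) • u ∈ hyperplaneSet u τ := by
    simp [hyperplaneSet, inner_sub_left, real_inner_smul_left, hu]
  apply le_antisymm
  · refine (Metric.infDist_le_dist_of_mem hmem).trans_eq ?_
    rw [dist_eq_norm, sub_sub_cancel, norm_smul, hu, mul_one, Real.norm_eq_abs]
  · refine (Metric.le_infDist ⟨_, hmem⟩).2 fun y hy => ?_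
    have hy' : ⟪y, u⟫ = τ := hy
    rw [dist_eq_norm, ← hy', ← inner_sub_left]
    simpa [hu] using abs_real_inner_le_norm (x - y) u

/-- Every hyperplane is `H(u, τ)` for some `τ ≥ 0`. -/
theorem exists_eq_of (H : Hyperplane n) :
    ∃ (u : Metric.sphere (0 : Euc n) 1) (τ : ℝ), 0 ≤ τ ∧ H = of u τ := by
  obtain ⟨u, hu, τ, h⟩ := H.2
  rcases le_total 0 τ with hτ | hτ
  · exact ⟨⟨u, by simpa using hu⟩, τ, hτ, Subtype.ext h⟩
  · refine ⟨⟨-u, by simpa using hu⟩, -τ, by linarith, Subtype.ext (h.trans ?_)⟩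
    ext x
    change ⟪x, u⟫ = τ ↔ ⟪x, -u⟫ = -τ
    simp

theorem infDist_of (u : Metric.sphere (0 : Euc n) 1) (τ : ℝ) (x : Euc n) :
    Metric.infDist x (of u τ).carrier = |⟪x, (u : Euc n)⟫ - τ| :=
  infDist_hyperplaneSet (by simp) τ x

theorem isClosed_carrier (H : Hyperplane n) : IsClosed H.carrier := by
  obtain ⟨u, -, τ, h⟩ := H.2
  rw [carrier, h]
  exact isClosed_eq (by fun_prop) (by fun_prop)

theorem carrier_nonempty (H : Hyperplane n) : H.carrier.Nonempty := by
  obtain ⟨u, hu, τ, h⟩ := H.2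
  refine ⟨τ • u, ?_⟩
  rw [carrier, h]
  simp [hyperplaneSet, real_inner_smul_left, hu]

theorem setOf_infDist_le (x : Euc n) (s : ℝ) :
    {H : Hyperplane n | Metric.infDist x H.carrier ≤ s} = hitting (Metric.closedBall x s) := by
  ext H
  simp only [hitting, mem_ofPred_eq]
  constructor
  · intro h
    obtain ⟨y, hy, hd⟩ := H.isClosed_carrier.exists_infDist_eq_dist H.carrier_nonempty x
    exact ⟨y, hy, by rw [Metric.mem_closedBall, dist_comm, ← hd]; exact h⟩
  · rintro ⟨y, hy, hyx⟩
    exact (Metric.infDist_le_dist_of_mem hy).trans (by rwa [dist_comm])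

theorem measurable_infDist (x : Euc n) :
    Measurable fun H : Hyperplane n => Metric.infDist x H.carrier := by
  refine measurable_of_Iic fun s => ?_
  change MeasurableSet {H : Hyperplane n | Metric.infDist x H.carrier ≤ s}
  rw [setOf_infDist_le]
  exact measurableSet_hitting (isCompact_closedBall x s)

/-- Distances to the points of a countable dense set determine a hyperplane. -/
instance : MeasurableSingletonClass (Hyperplane n) := by
  constructor
  intro H
  have : ({H} : Set (Hyperplane n)) = ⋂ k : ℕ, {H' | Metric.infDist
      (TopologicalSpace.denseSeq (Euc n) k) H'.carrier =
        Metric.infDist (TopologicalSpace.denseSeq (Euc n) k) H.carrier} := by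
    ext H'
    simp only [mem_singleton_iff, mem_iInter, mem_ofPred_eq]
    refine ⟨fun h k => by rw [h], fun h => ?_⟩
    have h2 : (fun x => Metric.infDist x H'.carrier) = fun x => Metric.infDist x H.carrier :=
      (TopologicalSpace.denseRange_denseSeq (Euc n)).equalizer
        (Metric.continuous_infDist_pt _) (Metric.continuous_infDist_pt _) (funext h)
    refine Subtype.ext (Set.ext fun x => ?_)
    change x ∈ H'.carrier ↔ x ∈ H.carrier
    rw [H'.isClosed_carrier.mem_iff_infDist_zero H'.carrier_nonempty,
      H.isClosed_carrier.mem_iff_infDist_zero H.carrier_nonempty]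
    exact Eq.congr_left (congrFun h2 x)
  rw [this]
  exact MeasurableSet.iInter fun k => measurable_infDist _ (measurableSet_singleton _)

/-- The distance of a hyperplane from the origin. -/
noncomputable def depth (H : Hyperplane n) : ℝ := Metric.infDist 0 H.carrier

/-- The component of `x` along the unit normal of `H` that points away from the origin, that is,
`⟪x, u⟫` for `H = H(u, τ)` with `τ > 0`. It is expressed through the distances of `x`, `-x` and `0`
from `H`, which makes its measurability evident; it is `0` if `H` contains the origin. -/
noncomputable def coord (x : Euc n) (H : Hyperplane n) : ℝ :=
  (Metric.infDist (-x) H.carrier ^ 2 - Metric.infDist x H.carrier ^ 2) / (4 * H.depth)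

theorem measurable_depth : Measurable (depth : Hyperplane n → ℝ) := measurable_infDist 0

theorem measurable_coord (x : Euc n) : Measurable (coord x) :=
  (((measurable_infDist _).pow_const 2).sub ((measurable_infDist _).pow_const 2)).div
    (measurable_depth.const_mul 4)

theorem depth_of (u : Metric.sphere (0 : Euc n) 1) {τ : ℝ} (hτ : 0 ≤ τ) :
    (of u τ).depth = τ := by
  rw [depth, infDist_of]
  simp [abs_of_nonneg hτ]

theorem coord_of (x : Euc n) (u : Metric.sphere (0 : Euc n) 1) {τ : ℝ} (hτ : 0 < τ) :
    coord x (of u τ) = ⟪x, (u : Euc n)⟫ := by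
  rw [coord, infDist_of, infDist_of, depth_of u hτ.le, sq_abs, sq_abs, inner_neg_left]
  field_simp
  ring

theorem depth_nonneg (H : Hyperplane n) : 0 ≤ H.depth := Metric.infDist_nonneg

theorem exists_eq_of_depth (H : Hyperplane n) :
    ∃ u : Metric.sphere (0 : Euc n) 1, H = of u H.depth := by
  obtain ⟨u, τ, hτ, h⟩ := H.exists_eq_of
  refine ⟨u, ?_⟩
  rw [h, depth_of u hτ]

theorem coord_eq {H : Hyperplane n} {u : Metric.sphere (0 : Euc n) 1} (h : H = of u H.depth)
    (hd : 0 < H.depth) (x : Euc n) : coord x H = ⟪x, (u : Euc n)⟫ := by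
  rw [h, coord_of x u hd]

/-- The functions `x ↦ coord x H` are linear of norm at most one, also for `H` through `0`. -/
theorem exists_coord_eq_inner (H : Hyperplane n) :
    ∃ v : Euc n, ‖v‖ ≤ 1 ∧ ∀ x, coord x H = ⟪x, v⟫ := by
  obtain ⟨u, hu⟩ := H.exists_eq_of_depth
  rcases H.depth_nonneg.eq_or_lt with h | h
  · exact ⟨0, by simp, fun x => by simp [coord, ← h]⟩
  · exact ⟨u, by simp, coord_eq hu h⟩

theorem rotate_of (ϑ : Euc n ≃ₗᵢ[ℝ] Euc n) (u : Metric.sphere (0 : Euc n) 1) (τ : ℝ) :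
    rotate ϑ (of u τ) = of ⟨ϑ u, by simp⟩ τ := by
  refine Subtype.ext (Set.ext fun y => ?_)
  change y ∈ ϑ '' hyperplaneSet (u : Euc n) τ ↔ y ∈ hyperplaneSet (ϑ u) τ
  simp only [hyperplaneSet, mem_image, mem_ofPred_eq]
  constructor
  · rintro ⟨x, hx, rfl⟩
    rw [ϑ.inner_map_map, hx]
  · intro hy
    exact ⟨ϑ.symm y, by rw [← ϑ.inner_map_map, ϑ.apply_symm_apply, hy], by simp⟩

end Hyperplane

section Direction

open Hyperplane

variable {Ω : Type*} [MeasurableSpace Ω] {n : ℕ} {P : Measure Ω}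
  {X : Ω → Measure (Hyperplane n)}

theorem IsIsotropicProcess.lintegral_rotate (hX : IsHyperplaneProcess X)
    (hi : IsIsotropicProcess P X) (ϑ : Euc n ≃ₗᵢ[ℝ] Euc n)
    (hϑ : LinearMap.det (ϑ.toLinearEquiv : Euc n →ₗ[ℝ] Euc n) = 1)
    {f : Hyperplane n → ℝ≥0∞} (hf : Measurable f) :
    ∫⁻ H, f (rotate ϑ H) ∂(intensityMeasure P X) = ∫⁻ H, f H ∂(intensityMeasure P X) := by
  have hm : Measurable fun ω => (X ω).map (rotate ϑ) :=
    (Measure.measurable_map _ (measurable_rotate ϑ)).comp hX.measurable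
  have hl : Measurable fun μ : Measure (Hyperplane n) => ∫⁻ H, f H ∂μ :=
    Measure.measurable_lintegral hf
  rw [intensityMeasure, Measure.lintegral_bind hX.measurable.aemeasurable hf.aemeasurable,
    Measure.lintegral_bind hX.measurable.aemeasurable
      (f := fun H => f (rotate ϑ H)) (hf.comp (measurable_rotate ϑ)).aemeasurable,
    ← lintegral_map hl hX.measurable, ← hi ϑ hϑ, lintegral_map hl hm]
  refine lintegral_congr fun ω => ?_
  rw [lintegral_map hf (measurable_rotate ϑ)]

/-- In dimension at least two, rotations act transitively on spheres about the origin: compose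
the reflection that maps `w` to `w'` with a reflection that fixes `w'`. -/
theorem exists_rotation_map_eq (hn : 2 ≤ n) {w w' : Euc n} (h : ‖w‖ = ‖w'‖) :
    ∃ ϑ : Euc n ≃ₗᵢ[ℝ] Euc n, LinearMap.det (ϑ.toLinearEquiv : Euc n →ₗ[ℝ] Euc n) = 1 ∧
      ϑ w = w' := by
  by_cases hw : w = w'
  · refine ⟨LinearIsometryEquiv.refl ℝ _, ?_, hw⟩
    exact LinearMap.det_id
  have hdet : ∀ v : Euc n, v ≠ 0 → LinearMap.det
      ((ℝ ∙ v)ᗮ.reflection.toLinearEquiv : Euc n →ₗ[ℝ] Euc n) = -1 := fun v hv => by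
    have := Submodule.det_reflection (𝕜 := ℝ) (ℝ ∙ v)ᗮ
    rw [Submodule.orthogonal_orthogonal, finrank_span_singleton hv, pow_one] at this
    exact this
  obtain ⟨z, hz, hz0⟩ : ∃ z ∈ (ℝ ∙ w')ᗮ, z ≠ 0 := by
    refine Submodule.exists_mem_ne_zero_of_ne_bot fun hbot => ?_
    have h1 := Submodule.finrank_add_finrank_orthogonal (𝕜 := ℝ) (ℝ ∙ w')
    have h2 := finrank_span_le_card (R := ℝ) ({w'} : Set (Euc n))
    rw [hbot, finrank_bot, finrank_euclideanSpace_fin] at h1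
    simp at h2
    omega
  refine ⟨(ℝ ∙ (w - w'))ᗮ.reflection.trans (ℝ ∙ z)ᗮ.reflection, ?_, ?_⟩
  · have : (((ℝ ∙ (w - w'))ᗮ.reflection.trans (ℝ ∙ z)ᗮ.reflection).toLinearEquiv :
        Euc n →ₗ[ℝ] Euc n) = ((ℝ ∙ z)ᗮ.reflection.toLinearEquiv : Euc n →ₗ[ℝ] Euc n) ∘ₗ
          ((ℝ ∙ (w - w'))ᗮ.reflection.toLinearEquiv : Euc n →ₗ[ℝ] Euc n) := rfl
    rw [this, LinearMap.det_comp, hdet _ hz0, hdet _ (sub_ne_zero.2 hw)]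
    norm_num
  · change (ℝ ∙ z)ᗮ.reflection ((ℝ ∙ (w - w'))ᗮ.reflection w) = w'
    rw [Submodule.reflection_sub h, Submodule.reflection_eq_self_iff]
    rw [Submodule.mem_orthogonal_singleton_iff_inner_right]
    rw [Submodule.mem_orthogonal_singleton_iff_inner_right] at hz
    rw [real_inner_comm]
    exact hz

/-- The law of `⟪w, u⟫` under the directional distribution `φ` depends only on `‖w‖`. -/
def IsRotationInvariant (φ : Measure (Metric.sphere (0 : Euc n) 1)) : Prop :=
  ∀ (g : ℝ → ℝ≥0∞), Measurable g → ∀ w w' : Euc n, ‖w‖ = ‖w'‖ →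
    ∫⁻ u, g ⟪w, (u : Euc n)⟫ ∂φ = ∫⁻ u, g ⟪w', (u : Euc n)⟫ ∂φ

/-- `Θ` is the image of the measure `2 γ dτ φ(du)` on `S^{n-1} × (0, ∞)` under `(u, τ) ↦ H(u, τ)`. -/
def HasPolarForm (Θ : Measure (Hyperplane n)) (γ : ℝ)
    (φ : Measure (Metric.sphere (0 : Euc n) 1)) : Prop :=
  ∀ f : Hyperplane n → ℝ≥0∞, Measurable f → ∫⁻ H, f H ∂Θ =
    ENNReal.ofReal (2 * γ) * ∫⁻ u, (∫⁻ τ in Ioi (0 : ℝ), f (Hyperplane.of u τ)) ∂φ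

theorem HasPolarForm.lintegral_eq_of_depth_le {Θ : Measure (Hyperplane n)} {γ : ℝ}
    {φ : Measure (Metric.sphere (0 : Euc n) 1)} (h : HasPolarForm Θ γ φ)
    {F : Hyperplane n → ℝ≥0∞} (hF : Measurable F) {c : ℝ}
    {g : Metric.sphere (0 : Euc n) 1 → ℝ≥0∞}
    (hFg : ∀ (u : Metric.sphere (0 : Euc n) 1) (τ : ℝ), 0 < τ →
        F (of u τ) = (Iic c).indicator 1 τ * g u) :
    ∫⁻ H, F H ∂Θ = ENNReal.ofReal (2 * γ) * (ENNReal.ofReal c * ∫⁻ u, g u ∂φ) := by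
  rw [h F hF, ← lintegral_const_mul' (ENNReal.ofReal c) _ ENNReal.ofReal_ne_top]
  congr 1
  refine lintegral_congr fun u => ?_
  rw [setLIntegral_congr_fun measurableSet_Ioi (fun τ hτ => hFg u τ hτ),
    lintegral_mul_const _ (measurable_one.indicator measurableSet_Iic),
    lintegral_indicator_one measurableSet_Iic, Measure.restrict_apply measurableSet_Iic,
    inter_comm, Ioi_inter_Iic]
  simp

theorem HasPolarForm.ae_depth_pos {Θ : Measure (Hyperplane n)} {γ : ℝ}
    {φ : Measure (Metric.sphere (0 : Euc n) 1)} (h : HasPolarForm Θ γ φ) :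
    Θ {H | H.depth = 0} = 0 := by
  have hm : MeasurableSet {H : Hyperplane n | H.depth = 0} :=
    measurable_depth (measurableSet_singleton 0)
  rw [← lintegral_indicator_one hm, h.lintegral_eq_of_depth_le (measurable_one.indicator hm)
    (c := 0) (g := 0)]
  · simp
  · intro u τ hτ
    rw [indicator_of_notMem]
    · simp
    · simpa [depth_of u hτ.le] using hτ.ne'

/-- The polar form of the intensity measure of an isotropic process, with a directional
distribution that inherits the isotropy. -/
theorem IsStationaryIsotropicPoisson.exists_direction {γ : ℝ} (hn : 2 ≤ n)
    (h : IsStationaryIsotropicPoisson P X γ) :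
    0 < γ ∧ ∃ φ : Measure (Metric.sphere (0 : Euc n) 1), IsProbabilityMeasure φ ∧
      IsRotationInvariant φ ∧ HasPolarForm (intensityMeasure P X) γ φ := by
  obtain ⟨hγ, φ, hφ, hf⟩ := h.intensity
  have hf : HasPolarForm (intensityMeasure P X) γ φ := hf
  refine ⟨hγ, φ, hφ, fun g hg w w' hw => ?_, hf⟩
  obtain ⟨ϑ, hϑ, hϑw⟩ := exists_rotation_map_eq hn hw.symm
  -- Test the intensity measure on the hyperplanes at distance at most one from the origin.
  let F : Hyperplane n → ℝ≥0∞ := fun H => (Iic (1 : ℝ)).indicator 1 H.depth * g (coord w H)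
  have hF : Measurable F :=
    ((measurable_one.indicator measurableSet_Iic).comp measurable_depth).mul
      (hg.comp (measurable_coord w))
  have h1 := hf.lintegral_eq_of_depth_le hF (g := fun u => g ⟪w, (u : Euc n)⟫) (c := 1)
    fun u τ hτ => by simp only [F, depth_of u hτ.le, coord_of w u hτ]
  have h2 := hf.lintegral_eq_of_depth_le (hF.comp (measurable_rotate ϑ))
    (g := fun u => g ⟪w', (u : Euc n)⟫) (c := 1) fun u τ hτ => by
    simp only [F, Function.comp_apply, rotate_of, depth_of _ hτ.le, coord_of _ _ hτ]
    rw [← hϑw, ϑ.inner_map_map]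
  have h3 := h.isotropic.lintegral_rotate h.process ϑ hϑ hF
  rw [h1] at h3
  simp only [Function.comp_apply] at h2
  rw [h3] at h2
  simpa using (ENNReal.mul_right_inj (by simpa using hγ) ENNReal.ofReal_ne_top).1 h2

end Direction

/-! ### Moments of rotation invariant laws and nets on the sphere -/

section Moments

variable {n : ℕ}

/-- The vertices of the cube `[-1, 1]ⁿ`, indexed by their sign patterns. -/
def signVec (ε : Fin n → Bool) : Euc n := WithLp.toLp 2 fun i => if ε i then 1 else -1

theorem norm_signVec (ε : Fin n → Bool) : ‖signVec ε‖ = √n := by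
  have : ∀ i, ‖signVec ε i‖ ^ 2 = 1 := fun i => by
    by_cases h : ε i <;> simp [signVec, h]
  rw [EuclideanSpace.norm_eq, Finset.sum_congr rfl fun i _ => this i]
  simp

theorem inner_signVec (ε : Fin n → Bool) (u : Euc n) :
    ⟪signVec ε, u⟫ = ∑ i, (if ε i then u i else -u i) := by
  rw [PiLp.inner_apply]
  refine Finset.sum_congr rfl fun i _ => ?_
  by_cases h : ε i <;> simp [signVec, h]

/-- The inner product of a unit vector with a random sign vector is subgaussian. -/
theorem sum_exp_inner_signVec_le (c : ℝ) {u : Euc n} (hu : ‖u‖ = 1) :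
    ∑ ε : Fin n → Bool, Real.exp ⟪c • signVec ε, u⟫ ≤ 2 ^ n * Real.exp (c ^ 2 / 2) := by
  have h1 : ∀ ε : Fin n → Bool, Real.exp ⟪c • signVec ε, u⟫ =
      ∏ i, Real.exp (c * (if ε i then u i else -u i)) := fun ε => by
    rw [real_inner_smul_left, inner_signVec, Finset.mul_sum, Real.exp_sum]
  have h2 : ∑ ε : Fin n → Bool, Real.exp ⟪c • signVec ε, u⟫ =
      ∏ i, ∑ b : Bool, Real.exp (c * (if b then u i else -u i)) := by
    rw [Finset.prod_univ_sum, Fintype.piFinset_univ]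
    exact Finset.sum_congr rfl fun ε _ => h1 ε
  have h3 : ∀ i, ∑ b : Bool, Real.exp (c * (if b then u i else -u i)) ≤
      2 * Real.exp (c ^ 2 * u i ^ 2 / 2) := fun i => by
    have := Real.cosh_le_exp_half_sq (c * u i)
    rw [Real.cosh_eq] at this
    simp only [Fintype.sum_bool, if_true, Bool.false_eq_true, if_false, mul_neg]
    rw [mul_pow] at this
    linarith
  rw [h2]
  refine (Finset.prod_le_prod (fun i _ => by positivity) fun i _ => h3 i).trans_eq ?_
  rw [Finset.prod_mul_distrib, ← Real.exp_sum, ← Finset.sum_div, ← Finset.mul_sum]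
  have h4 : ∑ i, u i ^ 2 = 1 := by
    rw [← EuclideanSpace.real_norm_sq_eq, hu, one_pow]
  rw [h4]
  simp

variable {φ : Measure (Metric.sphere (0 : Euc n) 1)}

/-- The marginals of a rotation invariant law on the sphere are subgaussian: by invariance the
exponential moment in the direction `x` is an average over the directions of sign vectors. -/
theorem IsRotationInvariant.lintegral_exp_le [IsProbabilityMeasure φ] (hφ : IsRotationInvariant φ)
    (hn : 0 < n) (x : Euc n) :
    ∫⁻ u, ENNReal.ofReal (Real.exp ⟪x, (u : Euc n)⟫) ∂φ ≤
      ENNReal.ofReal (Real.exp (‖x‖ ^ 2 / (2 * n))) := by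
  have hn' : (0 : ℝ) < n := by exact_mod_cast hn
  set c := ‖x‖ / √n
  have h1 : ∀ ε : Fin n → Bool, ∫⁻ u, ENNReal.ofReal (Real.exp ⟪x, (u : Euc n)⟫) ∂φ =
      ∫⁻ u, ENNReal.ofReal (Real.exp ⟪c • signVec ε, (u : Euc n)⟫) ∂φ := fun ε => by
    refine hφ (fun t => ENNReal.ofReal (Real.exp t)) (by fun_prop) _ _ ?_
    rw [norm_smul, norm_signVec, Real.norm_of_nonneg (by positivity), div_mul_cancel₀]
    positivity
  have h2 : (2 : ℝ≥0∞) ^ n * ∫⁻ u, ENNReal.ofReal (Real.exp ⟪x, (u : Euc n)⟫) ∂φ =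
      ∫⁻ u, ENNReal.ofReal (∑ ε : Fin n → Bool, Real.exp ⟪c • signVec ε, (u : Euc n)⟫) ∂φ := by
    have : (2 : ℝ≥0∞) ^ n * ∫⁻ u, ENNReal.ofReal (Real.exp ⟪x, (u : Euc n)⟫) ∂φ =
        ∑ ε : Fin n → Bool, ∫⁻ u, ENNReal.ofReal (Real.exp ⟪c • signVec ε, (u : Euc n)⟫) ∂φ := by
      rw [Finset.sum_congr rfl fun ε _ => (h1 ε).symm]
      simp
    rw [this, ← lintegral_finsetSum _ (fun ε _ => by fun_prop)]
    refine lintegral_congr fun u => ?_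
    rw [ENNReal.ofReal_sum_of_nonneg (fun _ _ => by positivity)]
  have h3 : (2 : ℝ≥0∞) ^ n * ∫⁻ u, ENNReal.ofReal (Real.exp ⟪x, (u : Euc n)⟫) ∂φ ≤
      2 ^ n * ENNReal.ofReal (Real.exp (‖x‖ ^ 2 / (2 * n))) := by
    rw [h2]
    calc _ ≤ ∫⁻ u, ENNReal.ofReal (2 ^ n * Real.exp (c ^ 2 / 2)) ∂φ :=
          lintegral_mono fun u => ENNReal.ofReal_le_ofReal
            (sum_exp_inner_signVec_le c (by simp))
      _ = _ := by
          rw [lintegral_const, measure_univ, mul_one, ENNReal.ofReal_mul (by positivity),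
            ENNReal.ofReal_pow (by norm_num)]
          congr 3
          · simp
          · rw [div_pow, Real.sq_sqrt hn'.le]; field_simp
  exact (ENNReal.mul_le_mul_iff_right (by simp) (by finiteness)).1 h3

theorem IsRotationInvariant.lintegral_exp_abs_le [IsProbabilityMeasure φ]
    (hφ : IsRotationInvariant φ) (hn : 0 < n) (x : Euc n) :
    ∫⁻ u, ENNReal.ofReal (Real.exp |⟪x, (u : Euc n)⟫|) ∂φ ≤
      ENNReal.ofReal (2 * Real.exp (‖x‖ ^ 2 / (2 * n))) := by
  calc _ ≤ ∫⁻ u, (ENNReal.ofReal (Real.exp ⟪x, (u : Euc n)⟫) +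
        ENNReal.ofReal (Real.exp ⟪-x, (u : Euc n)⟫)) ∂φ := by
        refine lintegral_mono fun u => ?_
        rw [← ENNReal.ofReal_add (by positivity) (by positivity), inner_neg_left]
        exact ENNReal.ofReal_le_ofReal (Real.exp_abs_le _)
    _ ≤ _ := by
        rw [lintegral_add_left (by fun_prop), two_mul,
          ENNReal.ofReal_add (by positivity) (by positivity)]
        refine add_le_add (hφ.lintegral_exp_le hn x) ?_
        simpa using hφ.lintegral_exp_le hn (-x)

theorem IsRotationInvariant.lintegral_sq [IsProbabilityMeasure φ] (hφ : IsRotationInvariant φ)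
    (x : Euc n) :
    n * ∫⁻ u, ENNReal.ofReal (⟪x, (u : Euc n)⟫ ^ 2) ∂φ = ENNReal.ofReal (‖x‖ ^ 2) := by
  have h1 : ∀ i : Fin n, ∫⁻ u, ENNReal.ofReal (⟪x, (u : Euc n)⟫ ^ 2) ∂φ =
      ∫⁻ u, ENNReal.ofReal (⟪EuclideanSpace.single i ‖x‖, (u : Euc n)⟫ ^ 2) ∂φ := fun i =>
    hφ (fun t => ENNReal.ofReal (t ^ 2)) (by fun_prop) _ _ (by simp)
  have h2 : n * ∫⁻ u, ENNReal.ofReal (⟪x, (u : Euc n)⟫ ^ 2) ∂φ =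
      ∑ i : Fin n, ∫⁻ u, ENNReal.ofReal (⟪EuclideanSpace.single i ‖x‖, (u : Euc n)⟫ ^ 2) ∂φ := by
    rw [Finset.sum_congr rfl fun i _ => (h1 i).symm]
    simp
  rw [h2, ← lintegral_finsetSum _ (fun ε _ => by fun_prop)]
  have h3 : ∀ u : Metric.sphere (0 : Euc n) 1, ∑ i : Fin n,
      ENNReal.ofReal (⟪EuclideanSpace.single i ‖x‖, (u : Euc n)⟫ ^ 2) =
        ENNReal.ofReal (‖x‖ ^ 2) := fun u => by
    have h4 : ∑ i, (u : Euc n) i ^ 2 = 1 := by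
      rw [← EuclideanSpace.real_norm_sq_eq]; simp
    rw [← ENNReal.ofReal_sum_of_nonneg (fun _ _ => by positivity)]
    congr 1
    have h5 : ∀ i, ⟪EuclideanSpace.single i ‖x‖, (u : Euc n)⟫ = ‖x‖ * (u : Euc n) i := fun i => by
      rw [EuclideanSpace.inner_single_left]; simp
    simp_rw [h5, mul_pow]
    rw [← Finset.mul_sum, h4, mul_one]
  rw [lintegral_congr h3]
  simp

/-- Anticoncentration: for `‖w‖ = √n` the variable `⟪w, u⟫` has second moment one and bounded
exponential moments, hence bounded fourth moment, so it is not concentrated near zero; by symmetry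
it is bounded away from zero on the positive side with fixed probability. -/
theorem IsRotationInvariant.measure_half_le [IsProbabilityMeasure φ] (hφ : IsRotationInvariant φ)
    (hn : 0 < n) {w : Euc n} (hw : ‖w‖ = √n) :
    ENNReal.ofReal (1 / 400) ≤ φ {u | 1 / 2 ≤ ⟪w, (u : Euc n)⟫} := by
  have hn' : (0 : ℝ) < n := by exact_mod_cast hn
  set Y : Metric.sphere (0 : Euc n) 1 → ℝ := fun u => ⟪w, (u : Euc n)⟫ with hY
  have hYm : Measurable Y := by fun_prop
  have hsq : ∫⁻ u, ENNReal.ofReal (Y u ^ 2) ∂φ = 1 := by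
    have h := hφ.lintegral_sq w
    rw [hw, Real.sq_sqrt hn'.le, ENNReal.ofReal_natCast] at h
    have h0 : (n : ℝ≥0∞) ≠ 0 := by exact_mod_cast hn.ne'
    exact (ENNReal.mul_right_inj h0 (by finiteness)).1 (by rw [h, mul_one])
  have hexp : ∫⁻ u, ENNReal.ofReal (Real.exp |Y u|) ∂φ ≤ ENNReal.ofReal 4 := by
    refine (hφ.lintegral_exp_abs_le hn w).trans (ENNReal.ofReal_le_ofReal ?_)
    rw [hw, Real.sq_sqrt hn'.le]
    have h1 : (n : ℝ) / (2 * n) = 1 / 2 := by field_simp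
    have h2 : Real.exp (1 / 2) ^ 2 = Real.exp 1 := by rw [← Real.exp_nat_mul]; norm_num
    rw [h1]
    nlinarith [Real.exp_one_lt_d9, Real.exp_pos (1 / 2)]
  have hsymm : φ {u | Y u ≤ -(1 / 2)} = φ {u | 1 / 2 ≤ Y u} := by
    have h := hφ ((Ici (1 / 2)).indicator 1) (measurable_one.indicator measurableSet_Ici) w (-w)
      (by simp)
    have h1 : ∀ v : Euc n, ∫⁻ u, (Ici (1 / 2 : ℝ)).indicator (1 : ℝ → ℝ≥0∞) ⟪v, (u : Euc n)⟫ ∂φ =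
        φ {u | 1 / 2 ≤ ⟪v, (u : Euc n)⟫} := fun v =>
      lintegral_indicator_one (s := {u : Metric.sphere (0 : Euc n) 1 | 1 / 2 ≤ ⟪v, (u : Euc n)⟫})
        (measurableSet_le measurable_const (by fun_prop))
    rw [h1, h1] at h
    rw [h]
    congr 1
    ext u
    simp only [hY, mem_ofPred_eq, inner_neg_left]
    constructor <;> intro h <;> linarith
  have hm1 : MeasurableSet {u | 1 / 2 ≤ Y u} := measurableSet_le measurable_const hYm
  have hm2 : MeasurableSet {u | Y u ≤ -(1 / 2)} := measurableSet_le hYm measurable_const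
  -- Integrate the inequality `y² ≤ 1/4 + e^{|y|}/16 + 96·1{|y| ≥ 1/2}`.
  have hpt : ∀ u, ENNReal.ofReal (Y u ^ 2) ≤ ENNReal.ofReal (1 / 4) +
      ENNReal.ofReal (1 / 16) * ENNReal.ofReal (Real.exp |Y u|) +
        ENNReal.ofReal 96 * ({u | 1 / 2 ≤ Y u} ∪ {u | Y u ≤ -(1 / 2)}).indicator 1 u := by
    intro u
    have he := Real.pow_div_factorial_le_exp |Y u| (abs_nonneg _) 4
    have h4 : |Y u| ^ 4 = Y u ^ 4 := by rw [Even.pow_abs (by decide)]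
    have h24 : ((4).factorial : ℝ) = 24 := by norm_num [Nat.factorial]
    rw [h4, h24] at he
    rw [← ENNReal.ofReal_mul (by norm_num), ← ENNReal.ofReal_add (by norm_num) (by positivity)]
    by_cases hu : u ∈ {u | 1 / 2 ≤ Y u} ∪ {u | Y u ≤ -(1 / 2)}
    · rw [indicator_of_mem hu, Pi.one_apply, mul_one,
        ← ENNReal.ofReal_add (by positivity) (by norm_num)]
      refine ENNReal.ofReal_le_ofReal ?_
      nlinarith [sq_nonneg (Y u ^ 2 - 192)]
    · rw [indicator_of_notMem hu, mul_zero, add_zero]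
      refine ENNReal.ofReal_le_ofReal ?_
      simp only [mem_union, mem_ofPred_eq, not_or, not_le] at hu
      nlinarith [Real.exp_pos |Y u|, hu.1, hu.2]
  have hint := lintegral_mono (μ := φ) hpt
  rw [hsq, lintegral_add_left (by fun_prop), lintegral_add_left (by fun_prop),
    lintegral_const_mul _ (by fun_prop),
    lintegral_const_mul _ (measurable_one.indicator (hm1.union hm2)), lintegral_const, measure_univ,
    mul_one, lintegral_indicator_one (hm1.union hm2)] at hint
  have hU : φ ({u | 1 / 2 ≤ Y u} ∪ {u | Y u ≤ -(1 / 2)}) ≤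
      ENNReal.ofReal 2 * φ {u | 1 / 2 ≤ Y u} := by
    refine (measure_union_le _ _).trans ?_
    rw [hsymm, ENNReal.ofReal_ofNat, two_mul]
  have hfin : φ {u | 1 / 2 ≤ Y u} ≠ ∞ := measure_ne_top _ _
  have hint2 : (1 : ℝ≥0∞) ≤ ENNReal.ofReal (1 / 4) + ENNReal.ofReal (1 / 16) * ENNReal.ofReal 4 +
      ENNReal.ofReal 96 * (ENNReal.ofReal 2 * φ {u | 1 / 2 ≤ Y u}) := hint.trans (by gcongr)
  rw [← ENNReal.ofReal_toReal hfin] at hint2 ⊢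
  have h0 : 0 ≤ (φ {u | 1 / 2 ≤ Y u}).toReal := ENNReal.toReal_nonneg
  rw [← ENNReal.ofReal_mul (by norm_num), ← ENNReal.ofReal_mul (by norm_num),
    ← ENNReal.ofReal_mul (by norm_num), ← ENNReal.ofReal_add (by norm_num) (by norm_num),
    ← ENNReal.ofReal_add (by norm_num) (by positivity), ENNReal.one_le_ofReal] at hint2
  refine ENNReal.ofReal_le_ofReal ?_
  linarith

end Moments

section Net

/-- A `δ`-separated set of points in the unit ball has at most `(1 + 2 / δ) ^ n` elements. -/
theorem card_le_of_separated {n : ℕ} {δ : ℝ} (hδ : 0 < δ) (s : Finset (Euc n))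
    (hs : ∀ c ∈ s, ‖c‖ ≤ 1) (h : ∀ c ∈ s, ∀ d ∈ s, c ≠ d → δ ≤ ‖c - d‖) :
    (s.card : ℝ) ≤ (1 + 2 / δ) ^ n := by
  set μ : Measure (Euc n) := volume
  have hδ2 : 0 < δ / 2 := by positivity
  have hρ : 0 < 1 + δ / 2 := by positivity
  have D : Set.Pairwise (s : Set (Euc n)) (Function.onFun Disjoint fun c => Metric.ball c (δ / 2)) := by
    rintro c hc d hd hcd
    apply Metric.ball_disjoint_ball
    rw [dist_eq_norm, add_halves]
    exact h c hc d hd hcd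
  have hsub : (⋃ c ∈ s, Metric.ball c (δ / 2)) ⊆ Metric.ball (0 : Euc n) (1 + δ / 2) := by
    refine iUnion₂_subset fun x hx => Metric.ball_subset_ball' ?_
    rw [dist_zero_right]
    linarith [hs x hx]
  have I : (s.card : ℝ≥0∞) * ENNReal.ofReal ((δ / 2) ^ n) * μ (Metric.ball 0 1) ≤
      ENNReal.ofReal ((1 + δ / 2) ^ n) * μ (Metric.ball 0 1) := by
    have h1 := measure_mono (μ := μ) hsub
    rw [measure_biUnion_finset D fun c _ => measurableSet_ball] at h1
    simp only [μ.addHaar_ball_of_pos _ hδ2, μ.addHaar_ball_of_pos _ hρ, finrank_euclideanSpace_fin,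
      Finset.sum_const, nsmul_eq_mul] at h1
    rwa [mul_assoc]
  have J := (ENNReal.mul_le_mul_iff_left (Metric.measure_ball_pos μ _ zero_lt_one).ne'
    measure_ball_lt_top.ne).1 I
  have K : (s.card : ℝ) * (δ / 2) ^ n ≤ (1 + δ / 2) ^ n := by
    have := ENNReal.toReal_le_of_le_ofReal (by positivity) J
    rwa [ENNReal.toReal_mul, ENNReal.toReal_ofReal (by positivity), ENNReal.toReal_natCast] at this
  have h2 : (1 + 2 / δ) ^ n = (1 + δ / 2) ^ n / (δ / 2) ^ n := by
    rw [← div_pow]; congr 1; field_simp; ring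
  rwa [h2, le_div_iff₀ (by positivity)]

/-- The unit sphere has a `δ`-net with at most `(1 + 2 / δ) ^ n` elements. -/
theorem exists_net (n : ℕ) {δ : ℝ} (hδ : 0 < δ) :
    ∃ s : Finset (Euc n), (s.card : ℝ) ≤ (1 + 2 / δ) ^ n ∧ (∀ w ∈ s, ‖w‖ = 1) ∧
      ∀ v : Euc n, ‖v‖ = 1 → ∃ w ∈ s, ‖v - w‖ ≤ δ := by
  classical
  -- Take a separated set of maximal cardinality.
  let S : Set (Finset (Euc n)) := {s | (∀ w ∈ s, ‖w‖ = 1) ∧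
    ∀ c ∈ s, ∀ d ∈ s, c ≠ d → δ ≤ ‖c - d‖}
  have hb : BddAbove (Finset.card '' S) := by
    refine ⟨⌊(1 + 2 / δ) ^ n⌋₊, ?_⟩
    rintro _ ⟨s, hs, rfl⟩
    exact Nat.le_floor (card_le_of_separated hδ s (fun c hc => (hs.1 c hc).le) hs.2)
  have hne : (Finset.card '' S).Nonempty := ⟨_, ∅, by simp [S], rfl⟩
  obtain ⟨s, hs, hsup⟩ := Nat.sSup_mem hne hb
  refine ⟨s, card_le_of_separated hδ s (fun c hc => (hs.1 c hc).le) hs.2, hs.1, fun v hv => ?_⟩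
  by_contra! hcon
  have hvs : v ∉ s := fun h => by
    have := hcon v h
    rw [sub_self, norm_zero] at this
    linarith
  have hins : insert v s ∈ S := by
    refine ⟨fun w hw => ?_, fun c hc d hd hcd => ?_⟩
    · rcases Finset.mem_insert.1 hw with rfl | hw
      exacts [hv, hs.1 w hw]
    · rcases Finset.mem_insert.1 hc with rfl | hc' <;> rcases Finset.mem_insert.1 hd with rfl | hd'
      · exact absurd rfl hcd
      · exact (hcon d hd').le
      · rw [norm_sub_rev]; exact (hcon c hc').le
      · exact hs.2 c hc' d hd' hcd
  have h1 := le_csSup hb ⟨_, hins, rfl⟩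
  rw [← hsup, Finset.card_insert_of_notMem hvs] at h1
  omega

end Net

/-! ### Geometry of the zero cell -/

section Cell

open Hyperplane

variable {n : ℕ} {μ : Measure (Hyperplane n)}

/-- The hyperplanes of a counting measure, listed with multiplicity. -/
theorem IsLocallyFiniteCounting.exists_eq_sum (hμ : IsLocallyFiniteCounting μ) :
    ∃ (I : Set ℕ) (h : I → Hyperplane n), (μ = Measure.sum fun i => Measure.dirac (h i)) ∧
      ∀ H, μ {H} ≠ 0 ↔ ∃ i, h i = H := by
  obtain ⟨⟨I, h, rfl⟩, -⟩ := hμ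
  refine ⟨I, h, rfl, fun H => ?_⟩
  rw [Measure.sum_apply _ (measurableSet_singleton H), Ne, ENNReal.tsum_eq_zero, not_forall]
  refine exists_congr fun i => ?_
  rw [Measure.dirac_apply' _ (measurableSet_singleton H)]
  simp [indicator]

theorem IsLocallyFiniteCounting.exists_atom (hμ : IsLocallyFiniteCounting μ)
    {f : Hyperplane n → ℝ≥0∞} (hf : Measurable f) (h0 : ∫⁻ H, f H ∂μ ≠ 0) :
    ∃ H, μ {H} ≠ 0 ∧ f H ≠ 0 := by
  obtain ⟨I, h, hsum, hat⟩ := hμ.exists_eq_sum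
  rw [hsum, lintegral_sum_measure, Ne, ENNReal.tsum_eq_zero, not_forall] at h0
  obtain ⟨i, hi⟩ := h0
  rw [lintegral_dirac' _ hf] at hi
  exact ⟨h i, (hat _).2 ⟨i, rfl⟩, hi⟩

theorem radiusM_mono_of_subset {C : Set (Euc n)} {r : ℝ} (hr : 0 < r)
    (h : C ⊆ Metric.closedBall 0 r) : radiusM C ≤ ENNReal.ofReal r :=
  sInf_le ⟨r, hr, h, rfl⟩

theorem le_radiusM_of_mem {C : Set (Euc n)} {x : Euc n} (h : x ∈ C) :
    ENNReal.ofReal ‖x‖ ≤ radiusM C := by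
  refine le_sInf ?_
  rintro _ ⟨r, -, hC, rfl⟩
  exact ENNReal.ofReal_le_ofReal (by simpa using hC h)

/-- If in every direction `v` some hyperplane separates the point at distance `r` from the origin,
then the zero cell lies in the ball of radius `r`. -/
theorem radiusM_zeroCell_le {r : ℝ} (hr : 0 < r)
    (h : ∀ v : Euc n, ‖v‖ = 1 → ∃ H, μ {H} ≠ 0 ∧ 0 < H.depth ∧ H.depth < r * coord v H) :
    radiusM (zeroCell μ) ≤ ENNReal.ofReal r := by
  refine radiusM_mono_of_subset hr (closure_minimal ?_ Metric.isClosed_closedBall)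
  intro y hy
  rw [mem_closedBall_zero_iff]
  by_contra! hlt
  have hy0 : 0 < ‖y‖ := hr.trans hlt
  obtain ⟨H, hH, hd, hlt2⟩ := h (‖y‖⁻¹ • y) (by simp [norm_smul, hy0.ne'])
  obtain ⟨u, hu⟩ := H.exists_eq_of_depth
  have h0 : (0 : Euc n) ∈ (hyperplaneUnion μ)ᶜ := by
    by_contra h0
    rw [connectedComponentIn_eq_empty h0] at hy
    exact hy
  have hpre : IsPreconnected (connectedComponentIn (hyperplaneUnion μ)ᶜ 0) :=
    isPreconnected_connectedComponentIn
  have hcont : ContinuousOn (fun x : Euc n => ⟪x, (u : Euc n)⟫)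
    (connectedComponentIn (hyperplaneUnion μ)ᶜ 0) := by fun_prop
  rw [coord_eq hu hd, real_inner_smul_left] at hlt2
  have hup : H.depth ≤ ⟪y, (u : Euc n)⟫ := by
    have h1 : 0 < ‖y‖⁻¹ * ⟪y, (u : Euc n)⟫ := by
      by_contra! hle
      nlinarith
    have h2 : r * (‖y‖⁻¹ * ⟪y, (u : Euc n)⟫) ≤ ‖y‖ * (‖y‖⁻¹ * ⟪y, (u : Euc n)⟫) := by gcongr
    rw [mul_inv_cancel_left₀ hy0.ne'] at h2
    exact (hlt2.trans_le h2).le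
  obtain ⟨z, hz, hzu⟩ := hpre.intermediate_value (mem_connectedComponentIn h0) hy hcont
    (⟨by simpa using hd.le, hup⟩ : H.depth ∈ Icc _ _)
  refine connectedComponentIn_subset _ _ hz (mem_biUnion (x := H) hH ?_)
  rw [hu]
  exact hzu

/-- A point that no hyperplane separates from the origin, not even after a reflection in the
origin, belongs to the zero cell. -/
theorem norm_le_radiusM_zeroCell {x : Euc n}
    (h : ∀ H, μ {H} ≠ 0 → |coord x H| < H.depth) :
    ENNReal.ofReal ‖x‖ ≤ radiusM (zeroCell μ) := by
  have hseg : segment ℝ 0 x ⊆ (hyperplaneUnion μ)ᶜ := by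
    rintro y hy hy2
    obtain ⟨H, hH, hyH⟩ := mem_iUnion₂.1 hy2
    obtain ⟨u, hu⟩ := H.exists_eq_of_depth
    have hH' := h H hH
    have hd : 0 < H.depth := (abs_nonneg _).trans_lt hH'
    rw [coord_eq hu hd] at hH'
    rw [hu] at hyH
    have hyu : ⟪y, (u : Euc n)⟫ = H.depth := hyH
    rw [segment_eq_image_lineMap] at hy
    obtain ⟨θ, ⟨hθ0, hθ1⟩, rfl⟩ := hy
    rw [AffineMap.lineMap_apply_module', sub_zero, add_zero, real_inner_smul_left] at hyu
    have := (abs_lt.1 hH').2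
    rcases le_total ⟪x, (u : Euc n)⟫ 0 with h0 | h0 <;> nlinarith
  refine le_radiusM_of_mem (subset_closure ?_)
  exact (convex_segment (0 : Euc n) x).isPreconnected.subset_connectedComponentIn
    (left_mem_segment ℝ 0 x) hseg (right_mem_segment ℝ 0 x)

end Cell

/-! ### The upper bound for the radius -/

section UpperBound

open Hyperplane

variable {n : ℕ}

/-- For the hyperplanes at distance at most `c` from the origin, the absolute component of `w` along
the normal; zero for all other hyperplanes. -/
noncomputable def nearCoord (c : ℝ) (w : Euc n) (H : Hyperplane n) : ℝ :=
  if H.depth ≤ c then |coord w H| else 0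

/-- For the hyperplanes at distance at most `c` from the origin, the amount by which `r v` lies
beyond the hyperplane; zero for all other hyperplanes. -/
noncomputable def nearExcess (c r : ℝ) (v : Euc n) (H : Hyperplane n) : ℝ :=
  if H.depth ≤ c then max (r * coord v H - H.depth) 0 else 0

theorem measurable_nearCoord (c : ℝ) (w : Euc n) : Measurable (nearCoord c w) :=
  Measurable.ite (measurableSet_le measurable_depth measurable_const)
    ((measurable_coord w).abs) measurable_const

theorem measurable_nearExcess (c r : ℝ) (w : Euc n) : Measurable (nearExcess c r w) :=
  Measurable.ite (measurableSet_le measurable_depth measurable_const)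
    ((((measurable_coord w).const_mul r).sub measurable_depth).max measurable_const)
    measurable_const

theorem nearCoord_nonneg (c : ℝ) (w : Euc n) (H : Hyperplane n) : 0 ≤ nearCoord c w H := by
  unfold nearCoord; split_ifs <;> positivity

theorem nearCoord_add_le (c : ℝ) (v w : Euc n) (H : Hyperplane n) :
    nearCoord c (v + w) H ≤ nearCoord c v H + nearCoord c w H := by
  obtain ⟨u, -, hu⟩ := H.exists_coord_eq_inner
  unfold nearCoord
  split_ifs
  · rw [hu, hu, hu, inner_add_left]
    exact abs_add_le _ _
  · simp

theorem nearCoord_smul (c a : ℝ) (v : Euc n) (H : Hyperplane n) :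
    nearCoord c (a • v) H = |a| * nearCoord c v H := by
  obtain ⟨u, -, hu⟩ := H.exists_coord_eq_inner
  unfold nearCoord
  split_ifs
  · rw [hu, hu, real_inner_smul_left, abs_mul]
  · simp

theorem nearCoord_le (c : ℝ) (v : Euc n) (H : Hyperplane n) :
    nearCoord c v H ≤ {H : Hyperplane n | H.depth ≤ c}.indicator (fun _ => ‖v‖) H := by
  obtain ⟨u, hu1, hu⟩ := H.exists_coord_eq_inner
  unfold nearCoord
  split_ifs with h
  · rw [hu, indicator_of_mem (by exact h)]
    refine (abs_real_inner_le_norm _ _).trans ?_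
    nlinarith [norm_nonneg v]
  · rw [indicator_of_notMem (by exact h)]

theorem nearExcess_le_add (c : ℝ) {r : ℝ} (hr : 0 ≤ r) (v w : Euc n) (H : Hyperplane n) :
    nearExcess c r w H ≤ nearExcess c r v H + r * nearCoord c (v - w) H := by
  obtain ⟨u, -, hu⟩ := H.exists_coord_eq_inner
  unfold nearExcess nearCoord
  split_ifs
  · rw [hu, hu, hu, inner_sub_left]
    have h1 : r * (⟪w, u⟫ - ⟪v, u⟫) ≤ r * |⟪v, u⟫ - ⟪w, u⟫| := by
      gcongr
      rw [abs_sub_comm]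
      exact le_abs_self _
    refine max_le ?_ ?_
    · have := le_max_left (r * ⟪v, u⟫ - H.depth) 0
      linarith
    · have := le_max_right (r * ⟪v, u⟫ - H.depth) 0
      have : 0 ≤ r * |⟪v, u⟫ - ⟪w, u⟫| := by positivity
      linarith
  · simp

/-- Passage from a net of directions to all directions. The integral of `nearCoord` is a seminorm,
hence bounded on the sphere by twice its maximum on the net, and it controls the variation of the
integral of `nearExcess`. So if the latter is large enough on the net, it is positive everywhere,
which yields a separating hyperplane in every direction. -/
theorem radiusM_zeroCell_le_of_net {μ : Measure (Hyperplane n)} (hμ : IsLocallyFiniteCounting μ)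
    {c r δ B : ℝ} (hr : 0 < r) (hδ : 0 < δ) (hδ2 : δ ≤ 1 / 2) (hB : 0 ≤ B)
    {s : Finset (Euc n)}
    (hs : ∀ v : Euc n, ‖v‖ = 1 → ∃ w ∈ s, ‖v - w‖ ≤ δ)
    (hQ : ∀ w ∈ s, ∫⁻ H, ENNReal.ofReal (nearCoord c w H) ∂μ ≤ ENNReal.ofReal B)
    (hF : ∀ w ∈ s, ENNReal.ofReal (r * (2 * δ * B)) <
      ∫⁻ H, ENNReal.ofReal (nearExcess c r w H) ∂μ) :
    radiusM (zeroCell μ) ≤ ENNReal.ofReal r := by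
  set Q : Euc n → ℝ≥0∞ := fun w => ∫⁻ H, ENNReal.ofReal (nearCoord c w H) ∂μ with hQdef
  have hQadd : ∀ v w, Q (v + w) ≤ Q v + Q w := fun v w => by
    rw [hQdef]
    simp only
    rw [← lintegral_add_left (measurable_nearCoord c v).ennreal_ofReal]
    refine lintegral_mono fun H => ?_
    rw [← ENNReal.ofReal_add (nearCoord_nonneg _ _ _) (nearCoord_nonneg _ _ _)]
    exact ENNReal.ofReal_le_ofReal (nearCoord_add_le c v w H)
  have hQsmul : ∀ (a : ℝ) v, Q (a • v) = ENNReal.ofReal |a| * Q v := fun a v => by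
    rw [hQdef]
    simp only [nearCoord_smul]
    rw [← lintegral_const_mul' _ _ ENNReal.ofReal_ne_top]
    refine lintegral_congr fun H => ?_
    rw [ENNReal.ofReal_mul (abs_nonneg a)]
  have hμc : μ {H | H.depth ≤ c} < ∞ := by
    have := hμ.2 _ (isCompact_closedBall (0 : Euc n) c)
    rwa [← setOf_infDist_le] at this
  have hms : MeasurableSet {H : Hyperplane n | H.depth ≤ c} :=
    measurableSet_le measurable_depth measurable_const
  have hQtop : ∀ v, ‖v‖ = 1 → Q v ≤ μ {H | H.depth ≤ c} := fun v hv => by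
    rw [← lintegral_indicator_one hms]
    refine lintegral_mono fun H => ?_
    refine (ENNReal.ofReal_le_ofReal (nearCoord_le c v H)).trans ?_
    by_cases h : H ∈ {H : Hyperplane n | H.depth ≤ c}
    · simp [indicator_of_mem h, hv]
    · simp [indicator_of_notMem h]
  set S : ℝ≥0∞ := ⨆ v : {v : Euc n // ‖v‖ = 1}, Q v with hS
  have hStop : S < ∞ := (iSup_le fun v : {v : Euc n // ‖v‖ = 1} => hQtop v v.2).trans_lt hμc
  have hQS : ∀ v, Q v ≤ ENNReal.ofReal ‖v‖ * S := fun v => by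
    rcases eq_or_ne v 0 with rfl | hv
    · simpa using hQsmul 0 0
    · have h0 : ‖v‖ ≠ 0 := norm_ne_zero_iff.2 hv
      have h1 : v = ‖v‖ • (‖v‖⁻¹ • v) := by rw [smul_smul, mul_inv_cancel₀ h0, one_smul]
      conv_lhs => rw [h1, hQsmul, abs_norm]
      gcongr
      exact le_iSup (fun v : {v : Euc n // ‖v‖ = 1} => Q v)
        ⟨‖v‖⁻¹ • v, by rw [norm_smul, norm_inv, norm_norm, inv_mul_cancel₀ h0]⟩
  have hSle : S ≤ ENNReal.ofReal (2 * B) := by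
    have h1 : S ≤ ENNReal.ofReal B + ENNReal.ofReal (1 / 2) * S := by
      refine iSup_le fun ⟨v, hv⟩ => ?_
      obtain ⟨w, hw, hvw⟩ := hs v hv
      calc Q v = Q (w + (v - w)) := by rw [add_sub_cancel]
        _ ≤ Q w + Q (v - w) := hQadd _ _
        _ ≤ _ := by
          refine add_le_add (hQ w hw) ((hQS _).trans ?_)
          gcongr
          exact hvw.trans hδ2
    rw [← ENNReal.ofReal_toReal hStop.ne] at h1 ⊢
    have h0 : 0 ≤ S.toReal := ENNReal.toReal_nonneg
    rw [← ENNReal.ofReal_mul (by norm_num), ← ENNReal.ofReal_add hB (by positivity),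
      ENNReal.ofReal_le_ofReal_iff (by positivity)] at h1
    exact ENNReal.ofReal_le_ofReal (by linarith)
  refine radiusM_zeroCell_le hr fun v hv => ?_
  obtain ⟨w, hw, hvw⟩ := hs v hv
  have hFv : ∫⁻ H, ENNReal.ofReal (nearExcess c r v H) ∂μ ≠ 0 := by
    intro h0
    refine (hF w hw).not_ge ?_
    calc ∫⁻ H, ENNReal.ofReal (nearExcess c r w H) ∂μ
        ≤ ∫⁻ H, (ENNReal.ofReal (nearExcess c r v H) +
            ENNReal.ofReal r * ENNReal.ofReal (nearCoord c (v - w) H)) ∂μ := by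
          refine lintegral_mono fun H => ?_
          rw [← ENNReal.ofReal_mul hr.le]
          exact (ENNReal.ofReal_le_ofReal (nearExcess_le_add c hr.le v w H)).trans
            ENNReal.ofReal_add_le
      _ = ENNReal.ofReal r * Q (v - w) := by
          rw [lintegral_add_left (measurable_nearExcess c r v).ennreal_ofReal, h0, zero_add,
            lintegral_const_mul' _ _ ENNReal.ofReal_ne_top]
      _ ≤ ENNReal.ofReal r * (ENNReal.ofReal δ * ENNReal.ofReal (2 * B)) := by
          gcongr
          refine (hQS _).trans ?_
          gcongr
      _ = _ := by
          rw [← ENNReal.ofReal_mul hδ.le, ← ENNReal.ofReal_mul hr.le]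
          ring_nf
  obtain ⟨H, hH, hHv⟩ := hμ.exists_atom (measurable_nearExcess c r v).ennreal_ofReal hFv
  refine ⟨H, hH, ?_⟩
  have hpos : 0 < nearExcess c r v H := by simpa using hHv
  unfold nearExcess at hpos
  split_ifs at hpos
  · have h1 : 0 < r * coord v H - H.depth := by
      by_contra! hle
      rw [max_eq_right hle] at hpos
      exact lt_irrefl _ hpos
    refine ⟨H.depth_nonneg.lt_of_ne fun h0 => ?_, by linarith⟩
    -- The coordinate vanishes for hyperplanes through the origin.
    simp [coord, ← h0] at h1
  · exact absurd hpos (lt_irrefl _)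

variable {Ω : Type*} [MeasurableSpace Ω] {P : Measure Ω} [IsProbabilityMeasure P]
  {X : Ω → Measure (Hyperplane n)} {γ : ℝ} {φ : Measure (Metric.sphere (0 : Euc n) 1)}

/-- The number `M` is four times the mean number `2 γ c` of hyperplanes at distance at most `c`; it
bounds the exponential moment of `nearCoord c (√n • w)`. -/
theorem measure_lintegral_nearCoord_gt_le [IsProbabilityMeasure φ] (hX : IsHyperplaneProcess X)
    (hP : IsPoissonProcess P X) (hφ : IsRotationInvariant φ)
    (hΘ : HasPolarForm (intensityMeasure P X) γ φ) (hγ : 0 < γ) (hn : 0 < n) {w : Euc n}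
    (hw : ‖w‖ = 1) {c M : ℝ} (hc : 0 < c) (hM : M = 8 * γ * c) :
    P {ω | ENNReal.ofReal (2 * M / √n) < ∫⁻ H, ENNReal.ofReal (nearCoord c w H) ∂(X ω)} ≤
      ENNReal.ofReal (Real.exp (-M)) := by
  have hn' : (0 : ℝ) < n := by exact_mod_cast hn
  have hM0 : 0 < M := by rw [hM]; positivity
  set x : Euc n := √n • w with hx
  have hxn : ‖x‖ = √n := by rw [hx, norm_smul, hw, mul_one, Real.norm_of_nonneg (by positivity)]
  have hms : MeasurableSet {H : Hyperplane n | H.depth ≤ c} :=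
    measurableSet_le measurable_depth measurable_const
  have hexp : ∫⁻ u, ENNReal.ofReal (Real.exp |⟪x, (u : Euc n)⟫|) ∂φ ≤ ENNReal.ofReal 4 := by
    refine (hφ.lintegral_exp_abs_le hn x).trans (ENNReal.ofReal_le_ofReal ?_)
    rw [hxn, Real.sq_sqrt hn'.le]
    have h1 : (n : ℝ) / (2 * n) = 1 / 2 := by field_simp
    have h2 : Real.exp (1 / 2) ^ 2 = Real.exp 1 := by rw [← Real.exp_nat_mul]; norm_num
    rw [h1]
    nlinarith [Real.exp_one_lt_d9, Real.exp_pos (1 / 2)]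
  have hC : ∫⁻ H, ENNReal.ofReal (Real.exp (nearCoord c x H) - 1) ∂(intensityMeasure P X) ≤
      ENNReal.ofReal M := by
    have h1 := hΘ.lintegral_eq_of_depth_le (c := c)
      (F := {H : Hyperplane n | H.depth ≤ c}.indicator
        fun H => ENNReal.ofReal (Real.exp |coord x H|))
      (g := fun u => ENNReal.ofReal (Real.exp |⟪x, (u : Euc n)⟫|))
      (Measurable.indicator (by have := measurable_coord x; fun_prop) hms)
      (fun u τ hτ => by
        by_cases h : τ ≤ c
        · rw [indicator_of_mem (by simpa [depth_of u hτ.le] using h), coord_of x u hτ,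
            indicator_of_mem (by exact h)]
          simp
        · rw [indicator_of_notMem (by simpa [depth_of u hτ.le] using h),
            indicator_of_notMem (by exact h)]
          simp)
    calc _ ≤ ∫⁻ H, {H : Hyperplane n | H.depth ≤ c}.indicator
            (fun H => ENNReal.ofReal (Real.exp |coord x H|)) H ∂(intensityMeasure P X) := by
          refine lintegral_mono fun H => ?_
          unfold nearCoord
          split_ifs with h
          · rw [indicator_of_mem (by exact h)]
            exact ENNReal.ofReal_le_ofReal (by linarith)
          · simp
      _ ≤ ENNReal.ofReal (2 * γ) * (ENNReal.ofReal c * ENNReal.ofReal 4) := by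
          rw [h1]
          gcongr
      _ = _ := by
          rw [← ENNReal.ofReal_mul hc.le, ← ENNReal.ofReal_mul (by positivity), hM]
          ring_nf
  have h := hP.measure_lintegral_gt_le hX (measurable_nearCoord c x) (nearCoord_nonneg c x)
    hM0.le hC (2 * M)
  rw [show M - 2 * M = -M by ring] at h
  refine le_trans (measure_mono fun ω hω => ?_) h
  simp only [mem_ofPred_eq] at hω ⊢
  have h2 : ∫⁻ H, ENNReal.ofReal (nearCoord c x H) ∂(X ω) =
      ENNReal.ofReal √n * ∫⁻ H, ENNReal.ofReal (nearCoord c w H) ∂(X ω) := by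
    rw [← lintegral_const_mul' _ _ ENNReal.ofReal_ne_top]
    refine lintegral_congr fun H => ?_
    rw [hx, nearCoord_smul, ENNReal.ofReal_mul (abs_nonneg _), abs_of_nonneg (by positivity)]
  have h3 : ENNReal.ofReal (2 * M) = ENNReal.ofReal √n * ENNReal.ofReal (2 * M / √n) := by
    rw [← ENNReal.ofReal_mul (by positivity)]
    congr 1
    field_simp
  rw [h2, h3]
  exact ENNReal.mul_lt_mul_right (by simpa using hn) ENNReal.ofReal_ne_top hω

/-- The excess is at least `c` for each hyperplane at distance at most `c` whose normal `u` satisfies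
`⟪w, u⟫ ≥ 2 c / r`, and the number of these is Poisson with mean at least `M / 1600`. -/
theorem measure_lintegral_nearExcess_le_le [IsProbabilityMeasure φ] (hX : IsHyperplaneProcess X)
    (hP : IsPoissonProcess P X) (hφ : IsRotationInvariant φ)
    (hΘ : HasPolarForm (intensityMeasure P X) γ φ) (hγ : 0 < γ) (hn : 0 < n) {w : Euc n}
    (hw : ‖w‖ = 1) {c r M : ℝ} (hr : 0 < r) (hc : c = r / (4 * √n)) (hM : M = 8 * γ * c) :
    P {ω | ∫⁻ H, ENNReal.ofReal (nearExcess c r w H) ∂(X ω) ≤ ENNReal.ofReal (c * (M / 6400))} ≤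
      ENNReal.ofReal (Real.exp (-(M / 6400))) := by
  have hn' : (0 : ℝ) < n := by exact_mod_cast hn
  have hc0 : 0 < c := by rw [hc]; positivity
  have hM0 : 0 < M := by rw [hM]; positivity
  set x : Euc n := √n • w with hx
  have hxn : ‖x‖ = √n := by rw [hx, norm_smul, hw, mul_one, Real.norm_of_nonneg (by positivity)]
  set A : Set (Hyperplane n) := {H | H.depth ≤ c} ∩ {H | 1 / 2 ≤ coord x H} with hA
  have hAm : MeasurableSet A := (measurableSet_le measurable_depth measurable_const).inter
    (measurableSet_le measurable_const (measurable_coord x))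
  have hBm : MeasurableSet {u : Metric.sphere (0 : Euc n) 1 | 1 / 2 ≤ ⟪x, (u : Euc n)⟫} :=
    measurableSet_le measurable_const (by fun_prop)
  have hΘA : intensityMeasure P X A = ENNReal.ofReal (2 * γ) * (ENNReal.ofReal c *
      φ {u | 1 / 2 ≤ ⟪x, (u : Euc n)⟫}) := by
    rw [← lintegral_indicator_one hAm, ← lintegral_indicator_one hBm]
    refine hΘ.lintegral_eq_of_depth_le (measurable_one.indicator hAm) fun u τ hτ => ?_
    simp only [hA, indicator, mem_inter_iff, mem_ofPred_eq, depth_of u hτ.le, coord_of x u hτ,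
      mem_Iic, Pi.one_apply]
    by_cases h1 : τ ≤ c <;> by_cases h2 : 1 / 2 ≤ ⟪x, (u : Euc n)⟫ <;> simp only [h1, h2] <;> simp
  have hfin : intensityMeasure P X A < ∞ := by
    rw [hΘA]
    finiteness
  have hθ : ENNReal.ofReal (M / 1600) ≤ intensityMeasure P X A := by
    rw [hΘA]
    calc ENNReal.ofReal (M / 1600)
        = ENNReal.ofReal (2 * γ) * (ENNReal.ofReal c * ENNReal.ofReal (1 / 400)) := by
          rw [← ENNReal.ofReal_mul hc0.le, ← ENNReal.ofReal_mul (by positivity), hM]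
          ring_nf
      _ ≤ _ := by
          gcongr
          exact hφ.measure_half_le hn hxn
  have h := hP.measure_count_le hX hAm hfin hθ (b := M / 6400) (by positivity)
  rw [show M / 6400 - M / 1600 / 2 = -(M / 6400) by ring] at h
  refine le_trans (measure_mono fun ω hω => ?_) h
  simp only [mem_ofPred_eq] at hω ⊢
  have h2 : ENNReal.ofReal c * X ω A ≤ ∫⁻ H, ENNReal.ofReal (nearExcess c r w H) ∂(X ω) := by
    rw [← lintegral_indicator_one hAm, ← lintegral_const_mul' _ _ ENNReal.ofReal_ne_top]
    refine lintegral_mono fun H => ?_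
    by_cases hH : H ∈ A
    · rw [indicator_of_mem hH, Pi.one_apply, mul_one]
      refine ENNReal.ofReal_le_ofReal ?_
      obtain ⟨hd, hco⟩ := hH
      simp only [mem_ofPred_eq] at hd hco
      obtain ⟨u, -, hu⟩ := H.exists_coord_eq_inner
      rw [nearExcess, if_pos hd]
      refine le_max_of_le_left ?_
      rw [hu, hx, real_inner_smul_left, ← hu] at hco
      have h3 : 2 * c * (√n * coord w H) * 2 = r * coord w H := by
        rw [hc]; field_simp; ring
      nlinarith
    · simp [indicator_of_notMem hH]
  have h3 := h2.trans hω
  rw [ENNReal.ofReal_mul hc0.le] at h3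
  exact (ENNReal.mul_le_mul_iff_right (by simpa using hc0) ENNReal.ofReal_ne_top).1 h3

/-- If the typical number `2 γ r / √n` of hyperplanes at distance of order `r / √n` from the origin
exceeds a large multiple of the dimension, the zero cell has radius less than `2 r` with high
probability. -/
theorem measure_radiusM_zeroCell_ge_le (h : IsStationaryIsotropicPoisson P X γ) (hn : 2 ≤ n)
    {r : ℝ} (hr : 0 < r) (hM : 100000 * n ≤ 2 * γ * r / √n) :
    P {ω | ENNReal.ofReal (2 * r) ≤ radiusM (zeroCell (X ω))} ≤
      ENNReal.ofReal (2 * Real.exp (-n)) := by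
  obtain ⟨hγ, φ, hφ1, hφ, hΘ⟩ := h.exists_direction hn
  have hn0 : 0 < n := by omega
  have hn' : (0 : ℝ) < n := by exact_mod_cast hn0
  set c := r / (4 * √n) with hc
  have hc0 : 0 < c := by positivity
  set M := 8 * γ * c with hMdef
  have hM0 : 0 < M := by positivity
  have hMn : 100000 * n ≤ M := by
    refine hM.trans_eq ?_
    rw [hMdef, hc]; field_simp; ring
  -- The mesh of the net; the exponents below beat the cardinality `204801 ^ n` of the net.
  set δ : ℝ := 1 / 102400 with hδ
  obtain ⟨s, hcard, hs1, hs⟩ := exists_net n (δ := δ) (by norm_num)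
  set E1 : Euc n → Set Ω := fun w =>
    {ω | ENNReal.ofReal (2 * M / √n) < ∫⁻ H, ENNReal.ofReal (nearCoord c w H) ∂(X ω)}
  set E2 : Euc n → Set Ω := fun w =>
    {ω | ∫⁻ H, ENNReal.ofReal (nearExcess c r w H) ∂(X ω) ≤ ENNReal.ofReal (c * (M / 6400))}
  have hsub : {ω | ENNReal.ofReal (2 * r) ≤ radiusM (zeroCell (X ω))} ⊆
      ⋃ w ∈ s, (E1 w ∪ E2 w) := by
    intro ω hω
    by_contra hcon
    simp only [mem_iUnion, not_exists, mem_union, not_or, E1, E2, mem_ofPred_eq, not_lt,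
      not_le] at hcon
    have h1 := radiusM_zeroCell_le_of_net (h.process.counting ω) hr (δ := δ) (by norm_num)
      (by norm_num [hδ]) (B := 2 * M / √n) (by positivity) hs (fun w hw => (hcon w hw).1)
      (fun w hw => lt_of_eq_of_lt (by
        rw [hδ, hc]
        congr 1
        field_simp
        norm_num) (hcon w hw).2)
    have h2 : ENNReal.ofReal (2 * r) ≤ ENNReal.ofReal r := le_trans hω h1
    rw [ENNReal.ofReal_le_ofReal_iff hr.le] at h2
    linarith
  have hE : ∀ w ∈ s, P (E1 w ∪ E2 w) ≤ ENNReal.ofReal (2 * Real.exp (-(15 * n))) := by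
    intro w hw
    refine (measure_union_le _ _).trans ?_
    rw [two_mul, ENNReal.ofReal_add (by positivity) (by positivity)]
    refine add_le_add ?_ ?_
    · refine (measure_lintegral_nearCoord_gt_le h.process h.poisson hφ hΘ hγ hn0 (hs1 w hw) hc0
        rfl).trans (ENNReal.ofReal_le_ofReal (Real.exp_le_exp.2 ?_))
      linarith
    · refine (measure_lintegral_nearExcess_le_le h.process h.poisson hφ hΘ hγ hn0 (hs1 w hw) hr
        rfl rfl).trans (ENNReal.ofReal_le_ofReal (Real.exp_le_exp.2 ?_))
      linarith
  have hcard2 : (s.card : ℝ) ≤ Real.exp (13 * n) := by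
    refine hcard.trans ?_
    have h13 : (1 + 2 / δ) ≤ Real.exp 13 := by
      have h1 : Real.exp 13 = Real.exp 1 ^ 13 := by rw [← Real.exp_nat_mul]; norm_num
      have h2 : (2.7 : ℝ) ^ 13 ≤ Real.exp 1 ^ 13 := by
        gcongr
        linarith [Real.exp_one_gt_d9]
      rw [h1]
      refine le_trans ?_ h2
      norm_num [hδ]
    calc (1 + 2 / δ) ^ n ≤ Real.exp 13 ^ n := by gcongr
      _ = Real.exp (13 * n) := by rw [← Real.exp_nat_mul, mul_comm]
  calc P {ω | ENNReal.ofReal (2 * r) ≤ radiusM (zeroCell (X ω))}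
      ≤ ∑ w ∈ s, P (E1 w ∪ E2 w) := (measure_mono hsub).trans (measure_biUnion_finset_le _ _)
    _ ≤ ∑ w ∈ s, ENNReal.ofReal (2 * Real.exp (-(15 * n))) := Finset.sum_le_sum hE
    _ = ENNReal.ofReal (s.card * (2 * Real.exp (-(15 * n)))) := by
        rw [Finset.sum_const, nsmul_eq_mul, ← ENNReal.ofReal_natCast,
          ← ENNReal.ofReal_mul (by positivity)]
    _ ≤ _ := by
        refine ENNReal.ofReal_le_ofReal ?_
        calc (s.card : ℝ) * (2 * Real.exp (-(15 * n)))
            ≤ Real.exp (13 * n) * (2 * Real.exp (-(15 * n))) := by gcongr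
          _ = 2 * Real.exp (-(2 * n)) := by
            rw [mul_left_comm, ← Real.exp_add]; ring_nf
          _ ≤ _ := by
            have : Real.exp (-(2 * n)) ≤ Real.exp (-n) := Real.exp_le_exp.2 (by linarith)
            linarith

end UpperBound

/-! ### Pigeonhole principle and rounding costs -/

section Pigeonhole

/-- If the words `b a`, for `a ∈ G`, all have probability at least `q` under a product of
subprobability weights, then there are at most `1 / q` different words, so that some word occurs at
least `q |G|` times. -/
theorem exists_large_fiber {α J : Type*} [Fintype J] (G : Finset α) (hG : G.Nonempty)
    (b : α → J → ℤ) (p : J → ℤ → ℝ) (hp : ∀ j k, 0 ≤ p j k)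
    (hp1 : ∀ j (T : Finset ℤ), ∑ k ∈ T, p j k ≤ 1) {q : ℝ}
    (hb : ∀ a ∈ G, q ≤ ∏ j, p j (b a j)) :
    ∃ a₀ ∈ G, ∃ S ⊆ G, q * G.card ≤ S.card ∧ ∀ a ∈ S, b a = b a₀ := by
  classical
  set W := G.image b with hW
  have hWq : q * W.card ≤ 1 := by
    let T : J → Finset ℤ := fun j => W.image fun β => β j
    calc q * W.card = ∑ β ∈ W, q := by rw [Finset.sum_const, nsmul_eq_mul, mul_comm]
      _ ≤ ∑ β ∈ W, ∏ j, p j (β j) := by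
          refine Finset.sum_le_sum fun β hβ => ?_
          obtain ⟨a, ha, rfl⟩ := Finset.mem_image.1 hβ
          exact hb a ha
      _ ≤ ∑ β ∈ Fintype.piFinset T, ∏ j, p j (β j) := by
          refine Finset.sum_le_sum_of_subset_of_nonneg (fun β hβ => ?_)
            fun β _ _ => Finset.prod_nonneg fun j _ => hp _ _
          exact Fintype.mem_piFinset.2 fun j => Finset.mem_image_of_mem _ hβ
      _ = ∏ j, ∑ k ∈ T j, p j k := (Finset.prod_univ_sum T p).symm
      _ ≤ 1 := Finset.prod_le_one (fun j _ => Finset.sum_nonneg fun k _ => hp _ _)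
          fun j _ => hp1 j _
  obtain ⟨β, hβ, hle⟩ := Finset.exists_le_card_fiber_of_nsmul_le_card_of_maps_to
    (s := G) (t := W) (f := b) (b := q * G.card) (fun a ha => Finset.mem_image_of_mem _ ha)
    (hG.image b) (by
      rw [nsmul_eq_mul]
      have : (0 : ℝ) ≤ G.card := by positivity
      nlinarith)
  obtain ⟨a₀, ha₀, rfl⟩ := Finset.mem_image.1 hβ
  exact ⟨a₀, ha₀, _, Finset.filter_subset _ _, hle, fun a ha => (Finset.mem_filter.1 ha).2⟩

/-- A Hamming ball of radius `n / 9` in the discrete cube has at most `e ^ (4 n / 9)` points. -/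
theorem card_hammingBall_le {n : ℕ} (ε₀ : Fin n → Bool) (S : Finset (Fin n → Bool))
    (hS : ∀ ε ∈ S, 9 * hammingDist ε ε₀ ≤ n) : (S.card : ℝ) ≤ Real.exp (4 * n / 9) := by
  have h1 : ∀ ε : Fin n → Bool, Real.exp (-(hammingDist ε ε₀ : ℝ)) =
      ∏ i, (if ε i = ε₀ i then 1 else Real.exp (-1)) := fun ε => by
    rw [Finset.prod_ite, Finset.prod_const_one, one_mul, Finset.prod_const, ← Real.exp_nat_mul]
    simp [hammingDist]
  have h2 : ∑ ε : Fin n → Bool, Real.exp (-(hammingDist ε ε₀ : ℝ)) = (1 + Real.exp (-1)) ^ n := by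
    rw [Finset.sum_congr rfl fun ε _ => h1 ε, ← Fintype.piFinset_univ,
      ← Finset.prod_univ_sum (fun _ => Finset.univ)
        (fun i b => if b = ε₀ i then (1 : ℝ) else Real.exp (-1))]
    have : ∀ i, ∑ b : Bool, (if b = ε₀ i then (1 : ℝ) else Real.exp (-1)) = 1 + Real.exp (-1) :=
      fun i => by cases ε₀ i <;> simp [add_comm]
    rw [Finset.prod_congr rfl fun i _ => this i]
    simp
  have h3 : S.card * Real.exp (-(n / 9 : ℝ)) ≤ (1 + Real.exp (-1)) ^ n := by
    rw [← h2, ← nsmul_eq_mul, ← Finset.sum_const]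
    refine (Finset.sum_le_sum fun ε hε => ?_).trans
      (Finset.sum_le_sum_of_subset_of_nonneg (Finset.subset_univ S) fun _ _ _ => by positivity)
    have : (9 * hammingDist ε ε₀ : ℝ) ≤ n := by exact_mod_cast hS ε hε
    exact Real.exp_le_exp.2 (by linarith)
  have h4 : 1 + Real.exp (-1) ≤ Real.exp (1 / 3) := by
    have h5 : Real.exp (-1) ≤ 0.368 := by
      rw [Real.exp_neg, inv_le_comm₀ (Real.exp_pos 1) (by norm_num)]
      exact le_trans (by norm_num) Real.exp_one_gt_d9.le
    have h7 : Real.exp (1 / 3) ^ 3 = Real.exp 1 := by rw [← Real.exp_nat_mul]; norm_num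
    by_contra! hlt
    have h8 : Real.exp (1 / 3) ^ 3 ≤ 1.368 ^ 3 :=
      pow_le_pow_left₀ (Real.exp_pos _).le (by linarith) 3
    rw [h7] at h8
    have := Real.exp_one_gt_d9
    norm_num at h8
    linarith
  have h5 : (1 + Real.exp (-1)) ^ n ≤ Real.exp (n / 3 : ℝ) := by
    calc (1 + Real.exp (-1)) ^ n ≤ Real.exp (1 / 3) ^ n := by gcongr
      _ = _ := by rw [← Real.exp_nat_mul]; ring_nf
  have h6 : Real.exp (4 * n / 9 : ℝ) = Real.exp (n / 3) * Real.exp (n / 9) := by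
    rw [← Real.exp_add]; ring_nf
  have h7 : Real.exp (-(n / 9 : ℝ)) * Real.exp (n / 9) = 1 := by rw [← Real.exp_add]; simp
  calc (S.card : ℝ) = S.card * Real.exp (-(n / 9 : ℝ)) * Real.exp (n / 9) := by
        rw [mul_assoc, h7, mul_one]
    _ ≤ _ := by
        rw [h6]
        gcongr
        exact h3.trans h5

end Pigeonhole

section RoundingCost

/-- An integrable function on `(0, ∞)` for which `(1 + g(t))²` dominates the normalizing constant
`∑ k, exp (-t |k|) = coth (t / 2)` of the two-sided geometric distribution. -/
noncomputable def latticeGap (t : ℝ) : ℝ :=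
  if t ≤ 1 then √2 * t ^ (-(1 / 2) : ℝ) else 2 * t ^ (-2 : ℝ)

theorem latticeGap_nonneg {t : ℝ} (ht : 0 ≤ t) : 0 ≤ latticeGap t := by
  unfold latticeGap; split_ifs <;> positivity

theorem measurable_latticeGap : Measurable latticeGap :=
  Measurable.ite measurableSet_Iic (by fun_prop) (by fun_prop)

/-- The two-sided geometric weights `exp (-t |k|) / (1 + latticeGap t)²` have sum at most one. -/
theorem sum_exp_neg_mul_abs_le {t : ℝ} (ht : 0 < t) (T : Finset ℤ) :
    ∑ k ∈ T, Real.exp (-(t * |(k : ℝ)|)) ≤ (1 + latticeGap t) ^ 2 := by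
  set r := Real.exp (-t) with hr
  have hr0 : 0 < r := Real.exp_pos _
  have hr1 : r < 1 := by rw [hr, Real.exp_lt_one_iff]; linarith
  have hg := hasSum_geometric_of_lt_one hr0.le hr1
  have hpow : ∀ m : ℕ, Real.exp (-(t * (m : ℝ))) = r ^ m := fun m => by
    rw [hr, ← Real.exp_nat_mul]; ring_nf
  have hs : HasSum (fun k : ℤ => Real.exp (-(t * |(k : ℝ)|))) ((1 - r)⁻¹ + r * (1 - r)⁻¹) := by
    refine HasSum.of_nat_of_neg_add_one ?_ ?_
    · simpa [hpow] using hg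
    · refine HasSum.congr_fun (hg.mul_left r) fun m => ?_
      rw [← pow_succ', ← hpow]
      push_cast
      rw [abs_neg, abs_of_nonneg (by positivity)]
  have h1 : ∑ k ∈ T, Real.exp (-(t * |(k : ℝ)|)) ≤ (1 - r)⁻¹ + r * (1 - r)⁻¹ :=
    sum_le_hasSum T (fun _ _ => by positivity) hs
  refine h1.trans ?_
  have hrt : r * Real.exp t = 1 := by rw [hr, ← Real.exp_add]; simp
  have hr1' : 0 < 1 - r := by linarith
  have hsum : (1 - r)⁻¹ + r * (1 - r)⁻¹ = (1 + r) / (1 - r) := by field_simp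
  have hq : r * (1 + t + t ^ 2 / 2) ≤ 1 := by
    refine le_trans ?_ hrt.le
    exact mul_le_mul_of_nonneg_left (Real.quadratic_le_exp_of_nonneg ht.le) hr0.le
  rw [hsum]
  unfold latticeGap
  split_ifs with h
  · have h2 : (√2 * t ^ (-(1 / 2) : ℝ)) ^ 2 = 2 / t := by
      rw [mul_pow, Real.sq_sqrt (by norm_num), ← Real.rpow_natCast, ← Real.rpow_mul ht.le]
      norm_num [Real.rpow_neg_one]
      rfl
    have h3 : 0 ≤ √2 * t ^ (-(1 / 2) : ℝ) := by positivity
    have h4 : (1 + r) / (1 - r) ≤ 1 + 2 / t := by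
      rw [div_le_iff₀ hr1', ← sub_nonneg]
      have : (1 + 2 / t) * (1 - r) - (1 + r) = 2 * (1 - r * (1 + t)) / t := by
        field_simp; ring
      rw [this]
      have : 0 ≤ r * (t ^ 2 / 2) := by positivity
      exact div_nonneg (by nlinarith) ht.le
    nlinarith
  · have h2 : t ^ (-2 : ℝ) = 1 / t ^ 2 := by
      rw [Real.rpow_neg ht.le, one_div]; norm_num
    rw [h2]
    have h4 : (1 + r) / (1 - r) ≤ 1 + 4 / t ^ 2 := by
      rw [div_le_iff₀ hr1', ← sub_nonneg]
      have : (1 + 4 / t ^ 2) * (1 - r) - (1 + r) = 4 * (1 - r * (1 + t ^ 2 / 2)) / t ^ 2 := by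
        field_simp; ring
      rw [this]
      have : 0 ≤ r * t := by positivity
      exact div_nonneg (by nlinarith) (by positivity)
    have h5 : 4 / t ^ 2 = 4 * (1 / t ^ 2) := by ring
    nlinarith [sq_nonneg (2 * (1 / t ^ 2))]

theorem mul_abs_round_le {t : ℝ} (ht : 0 < t) (x : ℝ) :
    t * |(round (x / t) : ℝ)| ≤ 2 * (if t ≤ 2 * |x| then |x| else 0) := by
  have habs : |x| = t * |x / t| := by
    rw [abs_div, abs_of_pos ht]; field_simp
  have h1 := abs_sub_round (x / t)
  split_ifs with h
  · have h2 : |(round (x / t) : ℝ)| ≤ |x / t| + 1 / 2 := by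
      have := abs_sub_abs_le_abs_sub (round (x / t) : ℝ) (x / t)
      rw [abs_sub_comm] at this
      linarith
    have h3 : t * |(round (x / t) : ℝ)| ≤ t * (|x / t| + 1 / 2) := by gcongr
    linarith
  · have h2 : |x / t| < 1 / 2 := by
      by_contra! h3
      have : t * (1 / 2) ≤ t * |x / t| := by gcongr
      rw [← habs] at this
      linarith
    have h3 : round (x / t) = 0 := by
      rw [round_eq_zero_iff]
      rw [abs_lt] at h2
      exact ⟨by linarith, h2.2⟩
    simp [h3]

end RoundingCost

/-! ### Far points of the zero cell from sign vectors -/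

section SignCost

open Hyperplane

variable {n : ℕ}

/-- Let `t = depth H / (2 s)`, and let `X` be the component of the sign vector `ε` along the normal
of `H`. The cost bounds half of `-log w`, where `w` is the weight `exp (-t |k|) / (1 + latticeGap t)²`
of the integer `k` nearest to `X / t`. These weights of the integers have sum at most one. -/
noncomputable def signCost (s : ℝ) (ε : Fin n → Bool) (H : Hyperplane n) : ℝ :=
  (if H.depth / (2 * s) ≤ 2 * |coord (signVec ε) H| then |coord (signVec ε) H| else 0) +
    Real.log (1 + latticeGap (H.depth / (2 * s)))

theorem measurable_signCost (s : ℝ) (ε : Fin n → Bool) : Measurable (signCost s ε) := by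
  have h1 : Measurable fun H : Hyperplane n => |coord (signVec ε) H| := (measurable_coord _).abs
  have h2 : Measurable fun H : Hyperplane n => H.depth / (2 * s) := measurable_depth.div_const _
  exact (Measurable.ite (measurableSet_le h2 (h1.const_mul 2)) h1 measurable_const).add
    (Real.measurable_log.comp (measurable_const.add (measurable_latticeGap.comp h2)))

theorem signCost_nonneg {s : ℝ} (hs : 0 < s) (ε : Fin n → Bool) (H : Hyperplane n) :
    0 ≤ signCost s ε H := by
  have hd := H.depth_nonneg
  have hg : 0 ≤ latticeGap (H.depth / (2 * s)) := latticeGap_nonneg (by positivity)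
  have hl := Real.log_nonneg (show 1 ≤ 1 + latticeGap (H.depth / (2 * s)) by linarith)
  unfold signCost
  split_ifs <;> positivity

theorem abs_coord_signVec_le (ε : Fin n → Bool) (H : Hyperplane n) :
    |coord (signVec ε) H| ≤ √n := by
  obtain ⟨u, hu1, hu⟩ := H.exists_coord_eq_inner
  rw [hu, ← norm_signVec ε]
  refine (abs_real_inner_le_norm _ _).trans ?_
  nlinarith [norm_nonneg (signVec ε)]

theorem coord_smul_sub (s : ℝ) (x y : Euc n) (H : Hyperplane n) :
    coord (s • (x - y)) H = s * (coord x H - coord y H) := by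
  obtain ⟨u, -, hu⟩ := H.exists_coord_eq_inner
  simp only [hu, real_inner_smul_left, inner_sub_left]

theorem norm_signVec_sub_sq (ε ε' : Fin n → Bool) :
    ‖signVec ε - signVec ε'‖ ^ 2 = 4 * hammingDist ε ε' := by
  have h : ∀ i, (signVec ε - signVec ε') i ^ 2 = if ε i ≠ ε' i then 4 else 0 := fun i => by
    rcases Bool.eq_false_or_eq_true (ε i) with h1 | h1 <;>
      rcases Bool.eq_false_or_eq_true (ε' i) with h2 | h2 <;> simp [signVec, h1, h2] <;> norm_num
  rw [EuclideanSpace.real_norm_sq_eq, Finset.sum_congr rfl fun i _ => h i, ← Finset.sum_filter,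
    Finset.sum_const, hammingDist, nsmul_eq_mul, mul_comm]

/-- If the total cost of a sign vector is on average at most `n / 20`, many sign vectors have the
same rounding with respect to all hyperplanes, so some two of them are at large Hamming distance.
Their difference, scaled by `s`, is a point of the zero cell far from the origin. -/
theorem lt_radiusM_zeroCell_of_signCost {μ : Measure (Hyperplane n)}
    (hμ : IsLocallyFiniteCounting μ) (hμ0 : μ {H | H.depth = 0} = 0) {s : ℝ} (hs : 0 < s)
    (hn : 15 ≤ n)
    (h : ∑ ε : Fin n → Bool, ∫⁻ H, ENNReal.ofReal (signCost s ε H) ∂μ ≤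
      2 ^ n * ENNReal.ofReal (n / 20)) :
    ENNReal.ofReal (2 * s * √n / 3) < radiusM (zeroCell μ) := by
  classical
  have hn' : (15 : ℝ) ≤ n := by exact_mod_cast hn
  obtain ⟨I, hI, hsum, hat⟩ := hμ.exists_eq_sum
  have hdpos : ∀ i, 0 < (hI i).depth := fun i => by
    refine (hI i).depth_nonneg.lt_of_ne fun h0 => ?_
    exact (hat (hI i)).2 ⟨i, rfl⟩ (measure_mono_null (by simpa using h0.symm) hμ0)
  set t : I → ℝ := fun i => (hI i).depth / (2 * s) with ht
  have htpos : ∀ i, 0 < t i := fun i => div_pos (hdpos i) (by positivity)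
  set F : (Fin n → Bool) → ℝ≥0∞ := fun ε => ∫⁻ H, ENNReal.ofReal (signCost s ε H) ∂μ
  have hF : ∀ ε, F ε = ∑' i, ENNReal.ofReal (signCost s ε (hI i)) := fun ε => by
    simp only [F]
    rw [hsum, lintegral_sum_measure]
    refine tsum_congr fun i => lintegral_dirac' _ (measurable_signCost s ε).ennreal_ofReal
  -- Only finitely many hyperplanes can have a nonzero rounding.
  have hfin : {i : I | t i ≤ 2 * √n}.Finite := by
    have h1 := hμ.2 _ (isCompact_closedBall (0 : Euc n) (4 * s * √n))
    rw [← setOf_infDist_le, hsum, Measure.sum_apply _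
      (measurableSet_le (measurable_infDist 0) measurable_const)] at h1
    refine (ENNReal.finite_const_le_of_tsum_ne_top h1.ne one_ne_zero).subset fun i hi => ?_
    have h2 : (hI i).depth ≤ 4 * s * √n := by
      have h3 : (hI i).depth / (2 * s) ≤ 2 * √n := hi
      rw [div_le_iff₀ (by positivity)] at h3
      linarith
    rw [mem_ofPred_eq, Measure.dirac_apply_of_mem (by exact h2)]
  set J : Finset I := hfin.toFinset with hJ
  set G : Finset (Fin n → Bool) := Finset.univ.filter fun ε => F ε ≤ ENNReal.ofReal (n / 10) with hG
  -- Markov's inequality for the uniform distribution on sign vectors.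
  have hGcard : (2 : ℝ) ^ n / 2 ≤ G.card := by
    set G' : Finset (Fin n → Bool) :=
      Finset.univ.filter fun ε => ¬ F ε ≤ ENNReal.ofReal (n / 10) with hG'
    have h1 : G.card + G'.card = 2 ^ n := by
      rw [hG, hG', Finset.card_filter_add_card_filter_not]
      simp
    have h2 : (G'.card : ℝ≥0∞) * ENNReal.ofReal (n / 10) ≤ 2 ^ n * ENNReal.ofReal (n / 20) := by
      rw [← nsmul_eq_mul, ← Finset.sum_const]
      refine le_trans (Finset.sum_le_sum fun ε hε => ?_)
        ((Finset.sum_le_sum_of_subset (Finset.subset_univ G')).trans h)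
      exact (not_le.1 (Finset.mem_filter.1 hε).2).le
    have h3 : (G'.card : ℝ) * (n / 10) ≤ 2 ^ n * (n / 20) := by
      have := ENNReal.toReal_mono (by finiteness) h2
      simpa [ENNReal.toReal_mul, ENNReal.toReal_ofReal, show (0 : ℝ) ≤ n / 10 by positivity,
        show (0 : ℝ) ≤ n / 20 by positivity] using this
    have h4 : (G.card : ℝ) + G'.card = 2 ^ n := by exact_mod_cast h1
    have h5 : (G'.card : ℝ) ≤ 2 ^ n / 2 := by
      refine le_of_mul_le_mul_right ?_ (show (0 : ℝ) < n / 10 by positivity)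
      linarith
    linarith
  have hGne : G.Nonempty := by
    rw [← Finset.card_pos]
    have : (0 : ℝ) < G.card := lt_of_lt_of_le (by positivity) hGcard
    exact_mod_cast this
  obtain ⟨ε₀, hε₀, S, hSG, hScard, hS⟩ := exists_large_fiber G hGne
    (fun ε (j : J) => round (coord (signVec ε) (hI j) / t j))
    (fun j k => Real.exp (-(t j * |(k : ℝ)|)) / (1 + latticeGap (t j)) ^ 2)
    (fun j k => by positivity)
    (fun j T => by
      have hg : 0 ≤ latticeGap (t j) := latticeGap_nonneg (htpos j).le
      rw [← Finset.sum_div]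
      exact div_le_one_of_le₀ (sum_exp_neg_mul_abs_le (htpos j) T) (by positivity))
    (q := Real.exp (-(n / 5)))
    (fun ε hε => by
      have h1 : ∑ j : J, signCost s ε (hI j) ≤ n / 10 := by
        have h2 : ∑ j : J, ENNReal.ofReal (signCost s ε (hI j)) ≤ ENNReal.ofReal (n / 10) := by
          refine le_trans ?_ (Finset.mem_filter.1 hε).2
          rw [hF, Finset.sum_coe_sort J fun i => ENNReal.ofReal (signCost s ε (hI i))]
          exact ENNReal.sum_le_tsum J
        rw [← ENNReal.ofReal_sum_of_nonneg (fun j _ => signCost_nonneg hs _ _)] at h2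
        exact (ENNReal.ofReal_le_ofReal_iff (by positivity)).1 h2
      have h3 : ∀ j : J, Real.exp (-(2 * signCost s ε (hI j))) ≤
          Real.exp (-(t j * |((round (coord (signVec ε) (hI j) / t j) : ℤ) : ℝ)|)) /
            (1 + latticeGap (t j)) ^ 2 := fun j => by
        have hg : 0 ≤ latticeGap (t j) := latticeGap_nonneg (htpos j).le
        have hround := mul_abs_round_le (htpos j) (coord (signVec ε) (hI j))
        rw [le_div_iff₀ (by positivity)]
        have h4 : (1 + latticeGap (t j)) ^ 2 =
            Real.exp (2 * Real.log (1 + latticeGap (t j))) := by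
          rw [two_mul, Real.exp_add, Real.exp_log (by positivity), sq]
        rw [h4, ← Real.exp_add]
        refine Real.exp_le_exp.2 ?_
        simp only [signCost]
        simp only [ht] at hround ⊢
        linarith
      calc Real.exp (-(n / 5)) ≤ Real.exp (∑ j : J, -(2 * signCost s ε (hI j))) := by
            refine Real.exp_le_exp.2 ?_
            rw [Finset.sum_neg_distrib, ← Finset.mul_sum]
            linarith
        _ ≤ _ := by
            rw [Real.exp_sum]
            exact Finset.prod_le_prod (fun j _ => by positivity) fun j _ => h3 j)
  obtain ⟨ε, hεS, hdist⟩ : ∃ ε ∈ S, n < 9 * hammingDist ε ε₀ := by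
    by_contra! hcon
    have h1 := card_hammingBall_le ε₀ S hcon
    have h2 : Real.exp (-(n / 5)) * (2 ^ n / 2) ≤ Real.exp (4 * n / 9) :=
      (mul_le_mul_of_nonneg_left hGcard (Real.exp_pos _).le).trans (hScard.trans h1)
    have h3 : (2 : ℝ) ^ n / 2 = Real.exp (n * Real.log 2 - Real.log 2) := by
      rw [Real.exp_sub, Real.exp_nat_mul, Real.exp_log (by norm_num)]
    rw [h3, ← Real.exp_add, Real.exp_le_exp] at h2
    have h4 := Real.log_two_gt_d9
    have h5 := Real.log_two_lt_d9
    nlinarith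
  set x : Euc n := s • (signVec ε - signVec ε₀) with hx
  have hxcell : ∀ H, μ {H} ≠ 0 → |coord x H| < H.depth := by
    intro H hH
    obtain ⟨i, rfl⟩ := (hat H).1 hH
    have hti : (hI i).depth = 2 * s * t i := by
      simp only [ht]; field_simp
    rw [hx, coord_smul_sub, abs_mul, abs_of_pos hs, hti]
    have hle : |coord (signVec ε) (hI i) - coord (signVec ε₀) (hI i)| ≤ t i := by
      by_cases hi : i ∈ J
      · have hr : round (coord (signVec ε) (hI i) / t i) =
            round (coord (signVec ε₀) (hI i) / t i) := congrFun (hS ε hεS) ⟨i, hi⟩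
        have h1 := abs_sub_round (coord (signVec ε) (hI i) / t i)
        have h2 := abs_sub_round (coord (signVec ε₀) (hI i) / t i)
        rw [hr] at h1
        have h3 : |coord (signVec ε) (hI i) / t i - coord (signVec ε₀) (hI i) / t i| ≤ 1 := by
          rw [abs_le] at h1 h2 ⊢
          constructor <;> linarith [h1.1, h1.2, h2.1, h2.2]
        rwa [← sub_div, abs_div, abs_of_pos (htpos i), div_le_one (htpos i)] at h3
      · have h1 : 2 * √n < t i := by simpa [hJ] using hi
        have h2 := abs_sub (coord (signVec ε) (hI i)) (coord (signVec ε₀) (hI i))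
        have h3 := abs_coord_signVec_le ε (hI i)
        have h4 := abs_coord_signVec_le ε₀ (hI i)
        linarith
    have := htpos i
    nlinarith
  refine lt_of_lt_of_le ?_ (norm_le_radiusM_zeroCell hxcell)
  rw [ENNReal.ofReal_lt_ofReal_iff_of_nonneg (by positivity), hx, norm_smul,
    Real.norm_of_nonneg hs.le]
  have hnorm : 2 * √n / 3 < ‖signVec ε - signVec ε₀‖ := by
    refine lt_of_pow_lt_pow_left₀ 2 (norm_nonneg _) ?_
    rw [norm_signVec_sub_sq, div_pow, mul_pow, Real.sq_sqrt (by positivity)]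
    have : (n : ℝ) < 9 * hammingDist ε ε₀ := by exact_mod_cast hdist
    linarith
  calc 2 * s * √n / 3 = s * (2 * √n / 3) := by ring
    _ < _ := by gcongr

end SignCost

/-! ### The lower bound for the radius -/

section LowerBound

open Hyperplane

variable {n : ℕ}

theorem lintegral_latticeGap_le :
    ∫⁻ t in Ioi (0 : ℝ), ENNReal.ofReal (latticeGap t) ≤ ENNReal.ofReal 5 := by
  have h1 : ∫⁻ t in Ioc (0 : ℝ) 1, ENNReal.ofReal (latticeGap t) = ENNReal.ofReal (√2 * 2) := by
    rw [setLIntegral_congr_fun (g := fun t => ENNReal.ofReal (√2 * t ^ (-(1 / 2) : ℝ)))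
      measurableSet_Ioc (fun t ht => by simp only [latticeGap, if_pos ht.2])]
    have hi : IntervalIntegrable (fun t : ℝ => √2 * t ^ (-(1 / 2) : ℝ)) volume 0 1 :=
      (intervalIntegral.intervalIntegrable_rpow' (by norm_num)).const_mul _
    rw [← ofReal_integral_eq_lintegral_ofReal
      ((intervalIntegrable_iff_integrableOn_Ioc_of_le zero_le_one).1 hi)
      ((ae_restrict_mem measurableSet_Ioc).mono fun t ht => by
        have := ht.1.le
        simp only [Pi.zero_apply]
        positivity), ← intervalIntegral.integral_of_le zero_le_one,
      intervalIntegral.integral_const_mul, integral_rpow (Or.inl (by norm_num))]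
    norm_num
  have h2 : ∫⁻ t in Ioi (1 : ℝ), ENNReal.ofReal (latticeGap t) = ENNReal.ofReal 2 := by
    rw [setLIntegral_congr_fun (g := fun t => ENNReal.ofReal (2 * t ^ (-2 : ℝ)))
      measurableSet_Ioi (fun t ht => by simp only [latticeGap, if_neg (not_le.2 (mem_Ioi.1 ht))]), ← ofReal_integral_eq_lintegral_ofReal
      ((integrableOn_Ioi_rpow_of_lt (by norm_num) one_pos).const_mul _)
      ((ae_restrict_mem measurableSet_Ioi).mono fun t ht => by
        have : (0 : ℝ) ≤ t := zero_le_one.trans (le_of_lt ht)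
        simp only [Pi.zero_apply]
        positivity), integral_const_mul, integral_Ioi_rpow_of_lt (by norm_num) one_pos]
    norm_num
  rw [← Ioc_union_Ioi_eq_Ioi zero_le_one, lintegral_union measurableSet_Ioi
    (Ioc_disjoint_Ioi le_rfl), h1, h2, ← ENNReal.ofReal_add (by positivity) (by norm_num)]
  refine ENNReal.ofReal_le_ofReal ?_
  have : √2 ≤ 1.5 := by
    rw [Real.sqrt_le_left (by norm_num)]; norm_num
  linarith

/-- The exponential moment of the rounding cost, integrated over all scales `t`. -/
theorem lintegral_exp_cost_le {a : ℝ} (ha : 0 ≤ a) :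
    ∫⁻ t in Ioi (0 : ℝ), ENNReal.ofReal (Real.exp ((if t ≤ 2 * a then a else 0) +
      Real.log (1 + latticeGap t)) - 1) ≤ ENNReal.ofReal (5 * Real.exp (2 * a)) := by
  have hpt : ∀ t ∈ Ioi (0 : ℝ), ENNReal.ofReal (Real.exp ((if t ≤ 2 * a then a else 0) +
      Real.log (1 + latticeGap t)) - 1) ≤
        (Iic (2 * a)).indicator (fun _ => ENNReal.ofReal (Real.exp a)) t +
          ENNReal.ofReal (Real.exp a) * ENNReal.ofReal (latticeGap t) := by
    intro t ht
    have hg : 0 ≤ latticeGap t := latticeGap_nonneg (le_of_lt ht)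
    have ha1 : 1 ≤ Real.exp a := Real.one_le_exp ha
    rw [Real.exp_add, Real.exp_log (by positivity), ← ENNReal.ofReal_mul (by positivity)]
    split_ifs with h
    · rw [indicator_of_mem (by exact h), ← ENNReal.ofReal_add (by positivity) (by positivity)]
      exact ENNReal.ofReal_le_ofReal (by linarith)
    · rw [indicator_of_notMem (by exact h), zero_add, Real.exp_zero]
      exact ENNReal.ofReal_le_ofReal (by nlinarith)
  calc _ ≤ ∫⁻ t in Ioi (0 : ℝ), ((Iic (2 * a)).indicator (fun _ => ENNReal.ofReal (Real.exp a)) t +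
          ENNReal.ofReal (Real.exp a) * ENNReal.ofReal (latticeGap t)) :=
        setLIntegral_mono' measurableSet_Ioi hpt
    _ ≤ ENNReal.ofReal (Real.exp a) * ENNReal.ofReal (2 * a) +
          ENNReal.ofReal (Real.exp a) * ENNReal.ofReal 5 := by
        rw [lintegral_add_left (measurable_const.indicator measurableSet_Iic),
          lintegral_indicator_const measurableSet_Iic, Measure.restrict_apply measurableSet_Iic,
          inter_comm, Ioi_inter_Iic, Real.volume_Ioc, sub_zero,
          lintegral_const_mul' _ _ ENNReal.ofReal_ne_top]
        gcongr
        exact lintegral_latticeGap_le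
    _ ≤ _ := by
        rw [← ENNReal.ofReal_mul (by positivity), ← ENNReal.ofReal_mul (by positivity),
          ← ENNReal.ofReal_add (by positivity) (by positivity)]
        refine ENNReal.ofReal_le_ofReal ?_
        rw [two_mul, Real.exp_add]
        nlinarith [Real.add_one_le_exp a, Real.exp_pos a]

theorem lintegral_comp_div_Ioi (F : ℝ → ℝ≥0∞) {c : ℝ} (hc : 0 < c) :
    ∫⁻ τ in Ioi (0 : ℝ), F (τ / c) = ENNReal.ofReal c * ∫⁻ t in Ioi (0 : ℝ), F t := by
  have hemb : MeasurableEmbedding fun τ : ℝ => c⁻¹ * τ :=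
    measurableEmbedding_mulLeft₀ (inv_ne_zero hc.ne')
  have h1 := hemb.lintegral_map (μ := volume) ((Ioi (0 : ℝ)).indicator F)
  rw [Real.map_volume_mul_left (inv_ne_zero hc.ne'), lintegral_smul_measure, inv_inv,
    abs_of_pos hc] at h1
  rw [← lintegral_indicator measurableSet_Ioi, ← lintegral_indicator measurableSet_Ioi]
  rw [smul_eq_mul] at h1
  rw [h1]
  refine lintegral_congr fun τ => ?_
  have : τ / c = c⁻¹ * τ := by rw [div_eq_inv_mul]
  simp only [indicator, mem_Ioi, this]
  by_cases h : 0 < τ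
  · rw [if_pos h, if_pos (by positivity)]
  · rw [if_neg h, if_neg]
    rw [← this]
    intro h2
    exact h ((div_pos_iff_of_pos_right hc).1 h2)

variable {Ω : Type*} [MeasurableSpace Ω] {P : Measure Ω} [IsProbabilityMeasure P]
  {X : Ω → Measure (Hyperplane n)} {γ : ℝ} {φ : Measure (Metric.sphere (0 : Euc n) 1)}

theorem HasPolarForm.lintegral_exp_signCost_le [IsProbabilityMeasure φ]
    {Θ : Measure (Hyperplane n)} (hφ : IsRotationInvariant φ) (hΘ : HasPolarForm Θ γ φ)
    (hγ : 0 < γ) (hn : 0 < n) {s : ℝ} (hs : 0 < s) (ε : Fin n → Bool) :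
    ∫⁻ H, ENNReal.ofReal (Real.exp (signCost s ε H) - 1) ∂Θ ≤ ENNReal.ofReal (320 * γ * s) := by
  have hn' : (0 : ℝ) < n := by exact_mod_cast hn
  have hm : Measurable fun H => ENNReal.ofReal (Real.exp (signCost s ε H) - 1) := by
    have := measurable_signCost s ε
    fun_prop
  rw [hΘ _ hm]
  have h1 : ∀ u : Metric.sphere (0 : Euc n) 1,
      ∫⁻ τ in Ioi (0 : ℝ), ENNReal.ofReal (Real.exp (signCost s ε (of u τ)) - 1) ≤
        ENNReal.ofReal (2 * s) * (ENNReal.ofReal 5 *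
          ENNReal.ofReal (Real.exp |⟪(2 : ℝ) • signVec ε, (u : Euc n)⟫|)) := fun u => by
    set a := |⟪signVec ε, (u : Euc n)⟫|
    let F : ℝ → ℝ≥0∞ := fun t => ENNReal.ofReal (Real.exp
      ((if t ≤ 2 * a then a else 0) + Real.log (1 + latticeGap t)) - 1)
    rw [setLIntegral_congr_fun (g := fun τ => F (τ / (2 * s)))
      measurableSet_Ioi (fun τ hτ => by
        simp only [signCost, depth_of u (le_of_lt hτ), coord_of _ u hτ, F, a]),
      lintegral_comp_div_Ioi F (by positivity)]
    gcongr
    refine (lintegral_exp_cost_le (abs_nonneg _)).trans_eq ?_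
    rw [← ENNReal.ofReal_mul (by norm_num), real_inner_smul_left, abs_mul,
      abs_of_pos (two_pos : (0 : ℝ) < 2)]
  have h2 : ∫⁻ u, ENNReal.ofReal (Real.exp |⟪(2 : ℝ) • signVec ε, (u : Euc n)⟫|) ∂φ ≤
      ENNReal.ofReal 16 := by
    refine (hφ.lintegral_exp_abs_le hn _).trans (ENNReal.ofReal_le_ofReal ?_)
    rw [norm_smul, norm_signVec, mul_pow, Real.sq_sqrt hn'.le]
    have h3 : ‖(2 : ℝ)‖ ^ 2 * n / (2 * n) = 2 := by
      rw [Real.norm_of_nonneg (by norm_num)]; field_simp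
    have h4 : Real.exp 2 = Real.exp 1 ^ 2 := by rw [← Real.exp_nat_mul]; norm_num
    rw [h3, h4]
    nlinarith [Real.exp_one_lt_d9, Real.exp_pos 1]
  calc _ ≤ ENNReal.ofReal (2 * γ) * (ENNReal.ofReal (2 * s) * (ENNReal.ofReal 5 *
          ENNReal.ofReal 16)) := by
        gcongr
        refine (lintegral_mono h1).trans ?_
        rw [lintegral_const_mul' _ _ ENNReal.ofReal_ne_top,
          lintegral_const_mul' _ _ ENNReal.ofReal_ne_top]
        gcongr
    _ = _ := by
        rw [← ENNReal.ofReal_mul (by norm_num), ← ENNReal.ofReal_mul (by positivity),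
          ← ENNReal.ofReal_mul (by positivity)]
        ring_nf

/-- If the typical number of hyperplanes near the origin at the relevant scale is at most a small
multiple of the dimension, the zero cell has a large radius with high probability. -/
theorem measure_radiusM_zeroCell_le_le (h : IsStationaryIsotropicPoisson P X γ) (hn : 15 ≤ n)
    {s : ℝ} (hs : 0 < s) (hγs : 12800 * (γ * s) ≤ n) :
    P {ω | radiusM (zeroCell (X ω)) ≤ ENNReal.ofReal (2 * s * √n / 3)} ≤
      ENNReal.ofReal (Real.exp (-(n / 40))) := by
  obtain ⟨hγ, φ, hφ1, hφ, hΘ⟩ := h.exists_direction (by omega)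
  set f : Hyperplane n → ℝ := fun H => ∑ ε : Fin n → Bool, (1 / 2 ^ n) * signCost s ε H with hf
  have hfm : Measurable f :=
    Finset.measurable_sum _ fun ε _ => (measurable_signCost s ε).const_mul _
  have hf0 : ∀ H, 0 ≤ f H := fun H =>
    Finset.sum_nonneg fun ε _ => mul_nonneg (by positivity) (signCost_nonneg hs ε H)
  have hw : ∑ ε : Fin n → Bool, (1 / 2 ^ n : ℝ) = 1 := by simp
  -- By convexity, the average over sign vectors inherits the exponential moment bound.
  have hC : ∫⁻ H, ENNReal.ofReal (Real.exp (f H) - 1) ∂(intensityMeasure P X) ≤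
      ENNReal.ofReal (n / 40) := by
    calc _ ≤ ∫⁻ H, ∑ ε : Fin n → Bool, ENNReal.ofReal (1 / 2 ^ n) *
            ENNReal.ofReal (Real.exp (signCost s ε H) - 1) ∂(intensityMeasure P X) := by
          refine lintegral_mono fun H => ?_
          have h1 := convexOn_exp.map_sum_le (t := Finset.univ) (w := fun _ => (1 / 2 ^ n : ℝ))
            (p := fun ε : Fin n → Bool => signCost s ε H) (fun _ _ => by positivity) hw
            (fun _ _ => mem_univ _)
          simp only [smul_eq_mul] at h1
          have h2 : ∀ ε : Fin n → Bool, 0 ≤ Real.exp (signCost s ε H) - 1 := fun ε => by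
            linarith [Real.one_le_exp (signCost_nonneg hs ε H)]
          simp only [← ENNReal.ofReal_mul (show (0 : ℝ) ≤ 1 / 2 ^ n by positivity)]
          rw [← ENNReal.ofReal_sum_of_nonneg
            (fun ε _ => mul_nonneg (by positivity) (h2 ε))]
          refine ENNReal.ofReal_le_ofReal ?_
          simp only [mul_sub, mul_one, Finset.sum_sub_distrib]
          rw [hw]
          exact sub_le_sub_right h1 1
      _ = ∑ ε : Fin n → Bool, ENNReal.ofReal (1 / 2 ^ n) *
            ∫⁻ H, ENNReal.ofReal (Real.exp (signCost s ε H) - 1) ∂(intensityMeasure P X) := by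
          rw [lintegral_finsetSum]
          · simp only [lintegral_const_mul' _ _ ENNReal.ofReal_ne_top]
          · intro ε _
            have := measurable_signCost s ε
            fun_prop
      _ ≤ ∑ ε : Fin n → Bool, ENNReal.ofReal (1 / 2 ^ n) * ENNReal.ofReal (320 * γ * s) := by
          gcongr with ε
          exact hΘ.lintegral_exp_signCost_le hφ hγ (by omega) hs ε
      _ ≤ _ := by
          rw [← Finset.sum_mul, ← ENNReal.ofReal_sum_of_nonneg (fun _ _ => by positivity), hw,
            ENNReal.ofReal_one, one_mul]
          exact ENNReal.ofReal_le_ofReal (by linarith)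
  have htail := h.poisson.measure_lintegral_gt_le h.process hfm hf0 (by positivity) hC (n / 20)
  rw [show (n : ℝ) / 40 - n / 20 = -(n / 40) by ring] at htail
  have hdepth : ∀ᵐ ω ∂P, X ω {H | H.depth = 0} = 0 := by
    have hm : MeasurableSet {H : Hyperplane n | H.depth = 0} :=
      measurable_depth (measurableSet_singleton 0)
    have h0 := hΘ.ae_depth_pos
    rw [intensityMeasure, Measure.bind_apply hm h.process.measurable.aemeasurable] at h0
    exact (lintegral_eq_zero_iff
      ((Measure.measurable_coe hm).comp h.process.measurable)).1 h0
  refine le_trans (measure_mono_ae ?_) htail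
  filter_upwards [hdepth] with ω hω hrad
  by_contra hcon
  have hcon' : ∫⁻ H, ENNReal.ofReal (f H) ∂(X ω) ≤ ENNReal.ofReal (n / 20) := not_lt.1 hcon
  refine (lt_radiusM_zeroCell_of_signCost (h.process.counting ω) hω hs hn ?_).not_ge hrad
  have h3 : ∑ ε : Fin n → Bool, ∫⁻ H, ENNReal.ofReal (signCost s ε H) ∂(X ω) =
      2 ^ n * ∫⁻ H, ENNReal.ofReal (f H) ∂(X ω) := by
    rw [← lintegral_finsetSum _ (fun ε _ => (measurable_signCost s ε).ennreal_ofReal),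
      ← lintegral_const_mul' _ _ (by finiteness)]
    refine lintegral_congr fun H => ?_
    have h4 : (2 : ℝ≥0∞) ^ n = ENNReal.ofReal (2 ^ n) := by
      rw [ENNReal.ofReal_pow (by norm_num), ENNReal.ofReal_ofNat]
    rw [← ENNReal.ofReal_sum_of_nonneg (fun ε _ => signCost_nonneg hs ε H), h4,
      ← ENNReal.ofReal_mul (by positivity)]
    simp only [hf, ← Finset.mul_sum]
    congr 1
    field_simp
  rw [h3]
  gcongr

end LowerBound

/-! ### Asymptotics -/

theorem tendsto_ofReal_mul_exp_neg_nat (a : ℝ) {c : ℝ} (hc : 0 < c) :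
    Tendsto (fun n : ℕ => ENNReal.ofReal (a * Real.exp (-(c * n)))) atTop (𝓝 0) := by
  have h1 : Tendsto (fun n : ℕ => c * (n : ℝ)) atTop atTop :=
    tendsto_natCast_atTop_atTop.const_mul_atTop hc
  have h2 := (Real.tendsto_exp_neg_atTop_nhds_zero.comp h1).const_mul a
  rw [mul_zero] at h2
  simpa [Function.comp_def] using (ENNReal.continuous_ofReal.tendsto 0).comp h2

theorem rpow_mul_rpow_three_halves_sub {n : ℕ} (hn : 0 < n) (α : ℝ) :
    (n : ℝ) ^ α * (n : ℝ) ^ (3 / 2 - α) = n * √n := by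
  have hn' : (0 : ℝ) < n := by exact_mod_cast hn
  rw [← Real.rpow_add hn', Real.sqrt_eq_rpow]
  nth_rewrite 2 [← Real.rpow_one (n : ℝ)]
  rw [← Real.rpow_add hn']
  norm_num

theorem eventually_between_of_isEquivalent {α ρ : ℝ} (hρ : 0 < ρ) {γ : ℕ → ℝ}
    (h : Asymptotics.IsEquivalent atTop γ (fun n : ℕ => ρ * (n : ℝ) ^ α)) :
    ∀ᶠ n : ℕ in atTop, ρ * (n : ℝ) ^ α / 2 ≤ γ n ∧ γ n ≤ 2 * (ρ * (n : ℝ) ^ α) := by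
  filter_upwards [h.isLittleO.bound (show (0 : ℝ) < 1 / 2 by norm_num)] with n hn
  have hpos : 0 ≤ ρ * (n : ℝ) ^ α := by positivity
  rw [Pi.sub_apply, Real.norm_eq_abs, Real.norm_of_nonneg hpos, abs_le] at hn
  constructor <;> linarith [hn.1, hn.2]

theorem theoremt (R : ℝ) (hR : 0 < R) :
    (∃ ρu : ℝ, √Real.pi / (R * √2) < ρu ∧
      ∀ (α ρ : ℝ), ρu < ρ →
      ∀ (γ : ℕ → ℝ), Asymptotics.IsEquivalent atTop γ (fun n : ℕ => ρ * (n : ℝ) ^ α) →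
      ∀ (Ω : ℕ → Type*) [∀ n, MeasurableSpace (Ω n)] (P : ∀ n, Measure (Ω n))
        [∀ n, IsProbabilityMeasure (P n)] (X : ∀ n, Ω n → Measure (Hyperplane n)),
        (∀ n, 1 ≤ n → IsStationaryIsotropicPoisson (P n) (X n) (γ n)) →
        Tendsto (fun n : ℕ => P n {ω | ENNReal.ofReal ((n : ℝ) ^ (3 / 2 - α) * R) ≤
          radiusM (zeroCell (X n ω))}) atTop (𝓝 0)) ∧
    (∃ ρl : ℝ, 0 < ρl ∧ ρl < √Real.pi / (R * √2) ∧
      ∀ (α ρ : ℝ), 0 < ρ → ρ < ρl →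
      ∀ (γ : ℕ → ℝ), Asymptotics.IsEquivalent atTop γ (fun n : ℕ => ρ * (n : ℝ) ^ α) →
      ∀ (Ω : ℕ → Type*) [∀ n, MeasurableSpace (Ω n)] (P : ∀ n, Measure (Ω n))
        [∀ n, IsProbabilityMeasure (P n)] (X : ∀ n, Ω n → Measure (Hyperplane n)),
        (∀ n, 1 ≤ n → IsStationaryIsotropicPoisson (P n) (X n) (γ n)) →
        Tendsto (fun n : ℕ => P n {ω | radiusM (zeroCell (X n ω)) ≤
          ENNReal.ofReal ((n : ℝ) ^ (3 / 2 - α) * R)}) atTop (𝓝 0)) := by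
  have hthr : 0 < √Real.pi / (R * √2) := by positivity
  constructor
  · refine ⟨√Real.pi / (R * √2) + 200000 / R, by linarith [show 0 < 200000 / R by positivity], ?_⟩
    intro α ρ hρ γ hγ Ω _ P _ X hX
    have hρR : 200000 ≤ ρ * R := by
      rw [← div_le_iff₀ hR]; linarith
    have hρ0 : 0 < ρ := by linarith [show 0 < 200000 / R by positivity]
    refine tendsto_of_tendsto_of_tendsto_of_le_of_le' tendsto_const_nhds
      (tendsto_ofReal_mul_exp_neg_nat 2 one_pos) (Eventually.of_forall fun _ => zero_le) ?_
    filter_upwards [eventually_between_of_isEquivalent hρ0 hγ, eventually_ge_atTop 2] with n hn hn2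
    have hn0 : (0 : ℝ) < n := by exact_mod_cast (show 0 < n by omega)
    have hpow := rpow_mul_rpow_three_halves_sub (show 0 < n by omega) α
    have hp : 0 < (n : ℝ) ^ (3 / 2 - α) := by positivity
    have h := measure_radiusM_zeroCell_ge_le (hX n (by omega)) hn2
      (r := (n : ℝ) ^ (3 / 2 - α) * R / 2) (by positivity) (by
        rw [le_div_iff₀ (by positivity)]
        calc 100000 * n * √n ≤ ρ * R / 2 * (n * √n) := by
              rw [mul_assoc]
              exact mul_le_mul_of_nonneg_right (by linarith) (by positivity)
          _ = ρ * (n : ℝ) ^ α / 2 * ((n : ℝ) ^ (3 / 2 - α) * R) := by rw [← hpow]; ring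
          _ ≤ γ n * ((n : ℝ) ^ (3 / 2 - α) * R) := by gcongr; exact hn.1
          _ = _ := by ring)
    rw [mul_div_cancel₀ _ two_ne_zero] at h
    rwa [one_mul]
  · set ρl := min (√Real.pi / (R * √2) / 2) (1 / (38400 * R)) with hρl
    refine ⟨ρl, by positivity, (min_le_left _ _).trans_lt (by linarith), ?_⟩
    intro α ρ hρ0 hρ γ hγ Ω _ P _ X hX
    have hρR : ρ * R ≤ 1 / 38400 := by
      have h1 : ρ ≤ 1 / (38400 * R) := (hρ.trans_le (min_le_right _ _)).le
      rw [le_div_iff₀ (by positivity)] at h1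
      linarith
    have hlim := tendsto_ofReal_mul_exp_neg_nat 1 (show (0 : ℝ) < 1 / 40 by norm_num)
    refine tendsto_of_tendsto_of_tendsto_of_le_of_le' tendsto_const_nhds hlim
      (Eventually.of_forall fun _ => zero_le) ?_
    filter_upwards [eventually_between_of_isEquivalent hρ0 hγ, eventually_ge_atTop 15] with n hn hn2
    have hn0 : (0 : ℝ) < n := by exact_mod_cast (show 0 < n by omega)
    have hpow := rpow_mul_rpow_three_halves_sub (show 0 < n by omega) α
    have hp : 0 < (n : ℝ) ^ (3 / 2 - α) := by positivity
    have h := measure_radiusM_zeroCell_le_le (hX n (by omega)) hn2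
      (s := 3 / 2 * ((n : ℝ) ^ (3 / 2 - α) * R) / √n) (by positivity) (by
        have h1 : γ n * (3 / 2 * ((n : ℝ) ^ (3 / 2 - α) * R) / √n) ≤ 3 * (ρ * R) * n := by
          rw [← mul_div_assoc, div_le_iff₀ (by positivity)]
          calc γ n * (3 / 2 * ((n : ℝ) ^ (3 / 2 - α) * R))
              ≤ 2 * (ρ * (n : ℝ) ^ α) * (3 / 2 * ((n : ℝ) ^ (3 / 2 - α) * R)) := by
                gcongr; exact hn.2
            _ = 3 * (ρ * R) * ((n : ℝ) ^ α * (n : ℝ) ^ (3 / 2 - α)) := by ring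
            _ = _ := by rw [hpow]; ring
        have h2 : ρ * R * n ≤ 1 / 38400 * n := by gcongr
        linarith)
    have h3 : 2 * (3 / 2 * ((n : ℝ) ^ (3 / 2 - α) * R) / √n) * √n / 3 =
        (n : ℝ) ^ (3 / 2 - α) * R := by
      field_simp
    rw [h3] at h
    rwa [one_mul, show (1 : ℝ) / 40 * n = n / 40 by ring]
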